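/- A lattice-ordered group ($\ell$-group) is a group with a lattice order preserved by multiplication on both sides. A distributive $\ell$-monoid is a monoid $\langle M,\cdot,\mathrm{e}\rangle$ with a distributive lattice structure $\langle M,\wedge,\vee\rangle$ such that $a(b\vee c)d=abd\vee acd$ and $a(b\wedge c)d=abd\wedge acd$ for all $a,b,c,d\in M$. An $\ell$-group equation over a set $X$ is a pair $s\approx t$ of terms built from variables in $X$ with $\wedge,\vee,\cdot,{}^{-1},\mathrm{e}$; it is inverse-free if ${}^{-1}$ does not occur in it. Theorem. Let $\varepsilon$ be any $\ell$-group equation with variables in a set $X$. Then a finite set $\Sigma$ of inverse-free equations with variables in $X\cup Y$, for some finite set $Y$ disjoint from $X$, can be effectively constructed such that $\varepsilon$ is valid in all $\ell$-groups if and only if the equations in $\Sigma$ are valid in all distributive $\ell$-monoids. (Effectively: the construction of $Y$ and $\Sigma$ from $\varepsilon$ commutes with injective renaming of the variables in $X$, and it is a computable function whenever the variables in $X$ are coded by natural numbers.) -/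

import Mathlib

universe u w

/-! ### Terms and equations -/

/-- Terms over a set `X` of variables in the language of lattice-ordered groups. -/
inductive LTerm (X : Type u) : Type u where
  | var : X → LTerm X
  | one : LTerm X
  | inv : LTerm X → LTerm X
  | mul : LTerm X → LTerm X → LTerm X
  | inf : LTerm X → LTerm X → LTerm X
  | sup : LTerm X → LTerm X → LTerm X

namespace LTerm

/-- The set of variables that occur in a term. -/
def vars {X : Type u} : LTerm X → Set X
  | var x => {x}
  | one => ∅
  | inv s => s.vars
  | mul s t => s.vars ∪ t.vars
  | inf s t => s.vars ∪ t.vars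
  | sup s t => s.vars ∪ t.vars

/-- The term obtained by renaming the variables along a map `e`. -/
def rename {X Z : Type u} (e : X → Z) : LTerm X → LTerm Z
  | var x => var (e x)
  | one => one
  | inv s => inv (s.rename e)
  | mul s t => mul (s.rename e) (t.rename e)
  | inf s t => inf (s.rename e) (t.rename e)
  | sup s t => sup (s.rename e) (t.rename e)

/-- A term is inverse-free if the inverse operation does not occur in it; these are exactly the
terms in the language of distributive lattice-ordered monoids. -/
def InverseFree {X : Type u} : LTerm X → Prop
  | var _ => True
  | one => True
  | inv _ => False
  | mul s t => s.InverseFree ∧ t.InverseFree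
  | inf s t => s.InverseFree ∧ t.InverseFree
  | sup s t => s.InverseFree ∧ t.InverseFree

/-- The value of a term in a group that carries a lattice structure. -/
def eval {X : Type u} {G : Type w} [Group G] [Lattice G] (v : X → G) : LTerm X → G
  | var x => v x
  | one => 1
  | inv s => (s.eval v)⁻¹
  | mul s t => s.eval v * t.eval v
  | inf s t => s.eval v ⊓ t.eval v
  | sup s t => s.eval v ⊔ t.eval v

/-- The value of an inverse-free term in a monoid that carries a lattice structure. -/
def evalFree {X : Type u} {M : Type w} [Monoid M] [Lattice M] (v : X → M) :
    (t : LTerm X) → t.InverseFree → M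
  | var x, _ => v x
  | one, _ => 1
  | inv _, h => False.elim h
  | mul s t, h => s.evalFree v h.1 * t.evalFree v h.2
  | inf s t, h => s.evalFree v h.1 ⊓ t.evalFree v h.2
  | sup s t, h => s.evalFree v h.1 ⊔ t.evalFree v h.2

/-! ### Terms as finite strings

A term is coded by its string in Polish (prefix) notation, over the alphabet that consists of the
variables and of the five operation symbols. -/

/-- The string of a term in Polish notation; the symbols `0, 1, 2, 3, 4` stand for the neutral
element, the inverse, the product, the meet and the join. -/
def toPolish {X : Type u} : LTerm X → List (X ⊕ Fin 5)
  | var x => [Sum.inl x]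
  | one => [Sum.inr 0]
  | inv s => Sum.inr 1 :: s.toPolish
  | mul s t => Sum.inr 2 :: (s.toPolish ++ t.toPolish)
  | inf s t => Sum.inr 3 :: (s.toPolish ++ t.toPolish)
  | sup s t => Sum.inr 4 :: (s.toPolish ++ t.toPolish)

/-- One step of reading a Polish string from right to left with a stack of terms. -/
def parseStep {X : Type u} : X ⊕ Fin 5 → List (LTerm X) → Option (List (LTerm X))
  | Sum.inl x, l => some (var x :: l)
  | Sum.inr 0, l => some (one :: l)
  | Sum.inr 1, s :: l => some (inv s :: l)
  | Sum.inr 2, s :: t :: l => some (mul s t :: l)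
  | Sum.inr 3, s :: t :: l => some (inf s t :: l)
  | Sum.inr 4, s :: t :: l => some (sup s t :: l)
  | _, _ => none

/-- Reading a Polish string from right to left with an initial stack of terms. -/
def parseStack {X : Type u} (st : List (LTerm X)) (l : List (X ⊕ Fin 5)) :
    Option (List (LTerm X)) :=
  l.foldr (fun a o => o.bind (parseStep a)) (some st)

/-- The term with a given Polish string, if there is one. -/
def ofPolish {X : Type u} (l : List (X ⊕ Fin 5)) : Option (LTerm X) :=
  (parseStack [] l).bind fun st =>
    match st with
    | [t] => some t
    | _ => none

theorem parseStack_append {X : Type u} (st : List (LTerm X)) (l l' : List (X ⊕ Fin 5)) :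
    parseStack st (l ++ l') = (parseStack st l').bind (fun st' => parseStack st' l) := by
  induction l with
  | nil => simp [parseStack]
  | cons a l ih =>
    have h : ∀ (st : List (LTerm X)) (k : List (X ⊕ Fin 5)),
        parseStack st (a :: k) = (parseStack st k).bind (parseStep a) := fun _ _ => rfl
    rw [List.cons_append, h, ih, Option.bind_assoc]
    rfl

theorem parseStack_toPolish {X : Type u} (t : LTerm X) (st : List (LTerm X)) :
    parseStack st t.toPolish = some (t :: st) := by
  have h : ∀ (a : X ⊕ Fin 5) (st : List (LTerm X)) (k : List (X ⊕ Fin 5)),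
      parseStack st (a :: k) = (parseStack st k).bind (parseStep a) := fun _ _ _ => rfl
  induction t generalizing st with
  | var x => rfl
  | one => rfl
  | inv s ih => rw [toPolish, h, ih]; rfl
  | mul s t ihs iht => rw [toPolish, h, parseStack_append, iht, Option.bind_some, ihs]; rfl
  | inf s t ihs iht => rw [toPolish, h, parseStack_append, iht, Option.bind_some, ihs]; rfl
  | sup s t ihs iht => rw [toPolish, h, parseStack_append, iht, Option.bind_some, ihs]; rfl

theorem ofPolish_toPolish {X : Type u} (t : LTerm X) : ofPolish t.toPolish = some t := by
  rw [ofPolish, parseStack_toPolish]; rfl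

theorem parseStep_toPolish {X : Type u} {a : X ⊕ Fin 5} {st st' : List (LTerm X)}
    (h : parseStep a st = some st') :
    st'.flatMap toPolish = a :: st.flatMap toPolish := by
  unfold parseStep at h
  split at h
  case h_7 => cases h
  all_goals
    rw [← Option.some.inj h]
    simp [toPolish]

theorem parseStack_eq_some {X : Type u} {l : List (X ⊕ Fin 5)} {st : List (LTerm X)}
    (h : parseStack [] l = some st) : st.flatMap toPolish = l := by
  induction l generalizing st with
  | nil =>
    have h' : some [] = some st := h
    cases h'
    rfl
  | cons a l ih =>
    have h' : (parseStack [] l).bind (parseStep a) = some st := h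
    obtain ⟨st₀, h₀, h₁⟩ := Option.bind_eq_some_iff.1 h'
    rw [parseStep_toPolish h₁, ih h₀]

theorem toPolish_of_ofPolish {X : Type u} {l : List (X ⊕ Fin 5)} {t : LTerm X}
    (h : ofPolish l = some t) : t.toPolish = l := by
  obtain ⟨st, h₀, h₁⟩ := Option.bind_eq_some_iff.1 h
  have h₂ := parseStack_eq_some h₀
  match st, h₁ with
  | [s], h₁ =>
    cases h₁
    simpa using h₂

/-- The number of arguments of a symbol. -/
def arity {X : Type u} : X ⊕ Fin 5 → ℕ :=
  Sum.elim (fun _ => 0) ![0, 1, 2, 2, 2]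

/-- The height of the stack after reading a Polish string, if reading does not fail. -/
def height {X : Type u} (l : List (X ⊕ Fin 5)) : Option ℕ :=
  l.foldr (fun a o => o.bind fun k => if arity a ≤ k then some (k - arity a + 1) else none) (some 0)

theorem parseStep_length {X : Type u} (a : X ⊕ Fin 5) (st : List (LTerm X)) :
    (parseStep a st).map List.length =
      if arity a ≤ st.length then some (st.length - arity a + 1) else none := by
  rcases a with x | i
  · simp [parseStep, arity]
  · fin_cases i <;> rcases st with _ | ⟨s, _ | ⟨t, st⟩⟩ <;> simp [parseStep, arity]

theorem height_eq {X : Type u} (l : List (X ⊕ Fin 5)) :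
    height l = (parseStack ([] : List (LTerm X)) l).map List.length := by
  induction l with
  | nil => rfl
  | cons a l ih =>
    have h₁ : height (a :: l) = (height l).bind fun k =>
      if arity a ≤ k then some (k - arity a + 1) else none := rfl
    have h₂ : parseStack ([] : List (LTerm X)) (a :: l) =
      (parseStack [] l).bind (parseStep a) := rfl
    rw [h₁, h₂, ih]
    cases parseStack ([] : List (LTerm X)) l with
    | none => rfl
    | some st => exact (parseStep_length a st).symm

theorem map_toPolish_ofPolish {X : Type u} (l : List (X ⊕ Fin 5)) :
    (ofPolish l).map toPolish = if height l = some 1 then some l else none := by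
  have key : height l = some 1 ↔ ∃ t, ofPolish l = some t := by
    rw [height_eq, Option.map_eq_some_iff]
    constructor
    · rintro ⟨st, h, hl⟩
      obtain ⟨t, rfl⟩ := List.length_eq_one_iff.1 hl
      exact ⟨t, by rw [ofPolish, h]; rfl⟩
    · rintro ⟨t, h⟩
      obtain ⟨st, h₀, h₁⟩ := Option.bind_eq_some_iff.1 h
      match st, h₁ with
      | [s], _ => exact ⟨[s], h₀, rfl⟩
  split_ifs with h
  · obtain ⟨t, ht⟩ := key.1 h
    rw [ht, Option.map_some, toPolish_of_ofPolish ht]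
  · cases ht : ofPolish l with
    | none => rfl
    | some t => exact absurd (key.2 ⟨t, ht⟩) h

theorem primrec_height {X : Type u} [Primcodable X] :
    Primrec (height : List (X ⊕ Fin 5) → Option ℕ) := by
  have har : Primrec (arity : X ⊕ Fin 5 → ℕ) :=
    (Primrec.sumCasesOn (f := fun a : X ⊕ Fin 5 => a) (g := fun _ _ => 0)
      (h := fun _ i => (![0, 1, 2, 2, 2] : Fin 5 → ℕ) i) Primrec.id (Primrec.const 0).to₂
      ((Primrec.dom_finite _).comp Primrec.snd).to₂).of_eq
      (fun a => by rcases a with x | i <;> rfl)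
  refine Primrec.list_foldr (σ := Option ℕ) (f := fun l : List (X ⊕ Fin 5) => l)
    (g := fun _ => some 0)
    (h := fun _ p => p.2.bind fun k => if arity p.1 ≤ k then some (k - arity p.1 + 1) else none)
    Primrec.id (Primrec.const _) ?_
  have ha : Primrec fun q : (List (X ⊕ Fin 5) × ((X ⊕ Fin 5) × Option ℕ)) × ℕ =>
      arity q.1.2.1 := har.comp (Primrec.fst.comp (Primrec.snd.comp Primrec.fst))
  refine Primrec.option_bind (Primrec.snd.comp Primrec.snd) ?_
  exact Primrec.ite (Primrec.nat_le.comp ha Primrec.snd)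
    (Primrec.option_some.comp (Primrec.succ.comp (Primrec.nat_sub.comp Primrec.snd ha)))
    (Primrec.const _)

/-- If the variables are coded by natural numbers, then so are the terms, as strings in Polish
notation. -/
instance instPrimcodable {X : Type u} [Primcodable X] : Primcodable (LTerm X) where
  encode t := Encodable.encode t.toPolish
  decode n := (Encodable.decode n : Option (List (X ⊕ Fin 5))).bind ofPolish
  encodek t := by rw [Encodable.encodek, Option.bind_some, ofPolish_toPolish]
  prim := by
    have h : Primrec fun n : ℕ => (Encodable.decode n : Option (List (X ⊕ Fin 5))).bind
        fun l => if height l = some 1 then some l else none :=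
      Primrec.option_bind Primrec.decode
        (Primrec.ite (Primrec.eq.comp (primrec_height.comp Primrec.snd) (Primrec.const _))
          (Primrec.option_some.comp Primrec.snd) (Primrec.const _))
    refine (Primrec.nat_iff.1 (Primrec.encode.comp h)).of_eq fun n => ?_
    have aux : ∀ o : Option (LTerm X), Encodable.encode (o.map toPolish) =
        @Encodable.encode (Option (LTerm X)) (@Option.encodable _
          ⟨fun t => Encodable.encode t.toPolish,
            fun n => (Encodable.decode n : Option (List (X ⊕ Fin 5))).bind ofPolish,
            fun t => by rw [Encodable.encodek, Option.bind_some, ofPolish_toPolish]⟩) o := by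
      intro o; cases o <;> rfl
    rw [← aux]
    congr 1
    cases (Encodable.decode n : Option (List (X ⊕ Fin 5))) with
    | none => rfl
    | some l => exact (map_toPolish_ofPolish l).symm

end LTerm

/-- An equation `s ≈ t` in the language of lattice-ordered groups, with variables in `X`, is the
pair of its two sides. -/
abbrev LEquation (X : Type u) : Type u := LTerm X × LTerm X

namespace LEquation

/-- The set of variables that occur in an equation. -/
def vars {X : Type u} (ε : LEquation X) : Set X := ε.1.vars ∪ ε.2.vars

/-- The equation obtained by renaming the variables along a map `e`. -/
def rename {X Z : Type u} (e : X → Z) (ε : LEquation X) : LEquation Z :=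
  (ε.1.rename e, ε.2.rename e)

/-- An equation is inverse-free if both its sides are. -/
def InverseFree {X : Type u} (ε : LEquation X) : Prop := ε.1.InverseFree ∧ ε.2.InverseFree

end LEquation

/-! ### Validity -/

/-- Distributive lattice-ordered monoids: a monoid that is a distributive lattice, in which
multiplication distributes over binary joins and meets on both sides. -/
class DistribLMonoid (M : Type w) extends Monoid M, DistribLattice M where
  mul_sup_mul (a b c d : M) : a * (b ⊔ c) * d = a * b * d ⊔ a * c * d
  mul_inf_mul (a b c d : M) : a * (b ⊓ c) * d = a * b * d ⊓ a * c * d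

/-- The equation `ε` is valid in all lattice-ordered groups: groups with a lattice order that is
preserved by left and right multiplication. -/
def LEquation.ValidLG {X : Type u} (ε : LEquation X) : Prop :=
  ∀ (G : Type w) [Group G] [Lattice G] [MulLeftMono G] [MulRightMono G] (v : X → G),
    ε.1.eval v = ε.2.eval v

/-- The inverse-free equation `ε` is valid in all distributive lattice-ordered monoids. -/
def LEquation.ValidDLM {X : Type u} (ε : LEquation X) (h : ε.InverseFree) : Prop :=
  ∀ (M : Type w) [DistribLMonoid M] (v : X → M), ε.1.evalFree v h.1 = ε.2.evalFree v h.2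

/-! An equation `s ≈ t` holds in an ℓ-group iff `1 ≤ s⁻¹t ∧ t⁻¹s`. Writing the right side as a meet
of joins of group words (`cnf`) leaves finitely many inequalities `1 ≤ ⋁ C`. A Holland-type
representation by prime ideals, available for all distributive ℓ-monoids (`exists_isLatticeAction`),
shows failure at a single point of a chain: `1 ≤ ⋁ C` fails in some ℓ-group iff, for some action on
a chain, some point `q` has `w q < q` for every `w ∈ C`.

The inverse-free equation of `C` puts a meet of words below a join of words. It fails iff, for some
action by monotone maps, there are a point `o` and a level `m` with `a o ≥ m > b o` for all words
`a` of the meet and `b` of the join. Each suffix `S` of the token list has two fresh variables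
`y_S`, `z_S`, and `y₀`, `z₀` belong to the base point. For automorphisms, put `q_S = y_S⁻¹ m` and `q
= y₀⁻¹ m`. Comparing through a point `z o`, the pair of a letter `a` says `a q_S < q_{aS}`, also
when `a` is an inverse, and the pairs of a separator say `q_S < q < q_{none S}`. Chaining along a
word gives `w q < q`.

Conversely, if all `w q < q`, then step functions `y_S` and constant maps `z_S` satisfy these
conditions (`not_validDLM_clauseEquation`). The remaining gap, from monotone maps to automorphisms,
is closed by `exists_orderIso_wordAct_lt`: the preorder of the finitely many words involved is
refined until each letter acts strictly, embedded in a countable dense chain, and the resulting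
finite partial isomorphisms are extended by back and forth. -/

/-! ### Computability of structural recursion on terms -/

namespace LTerm

section Primrec

variable {X : Type u} [Primcodable X] {σ : Type*} [Primcodable σ]

theorem primrec_toPolish : Primrec (toPolish : LTerm X → List (X ⊕ Fin 5)) :=
  Primrec.encode_iff.1 Primrec.encode

theorem primrec_iff_toPolish {α : Type*} [Primcodable α] {f : α → LTerm X} :
    Primrec f ↔ Primrec fun a => (f a).toPolish :=
  ⟨primrec_toPolish.comp, fun h => by
    have h' := Primrec.encode_iff.2 h
    exact Primrec.encode_iff.1 h'⟩

theorem primrec_var : Primrec (var : X → LTerm X) :=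
  primrec_iff_toPolish.2 (Primrec.list_cons.comp Primrec.sumInl (Primrec.const []))

theorem primrec_inv : Primrec (inv : LTerm X → LTerm X) :=
  primrec_iff_toPolish.2 (Primrec.list_cons.comp (Primrec.const _) primrec_toPolish)

theorem primrec_cons_append (i : X ⊕ Fin 5) :
    Primrec₂ fun s t : LTerm X => i :: (s.toPolish ++ t.toPolish) :=
  Primrec.list_cons.comp₂ (Primrec₂.const i)
    (Primrec.list_append.comp₂ (primrec_toPolish.comp₂ Primrec₂.left)
      (primrec_toPolish.comp₂ Primrec₂.right))

theorem primrec_mul : Primrec₂ (mul : LTerm X → LTerm X → LTerm X) :=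
  primrec_iff_toPolish.2 (primrec_cons_append (Sum.inr 2))

theorem primrec_inf : Primrec₂ (inf : LTerm X → LTerm X → LTerm X) :=
  primrec_iff_toPolish.2 (primrec_cons_append (Sum.inr 3))

theorem primrec_sup : Primrec₂ (sup : LTerm X → LTerm X → LTerm X) :=
  primrec_iff_toPolish.2 (primrec_cons_append (Sum.inr 4))

/-- One step of evaluating a Polish string from right to left with a stack of values. -/
def stackStep {X : Type u} {σ : Type*} [Inhabited σ] (gv : X → σ) (go : σ) (gi : σ → σ)
    (gm gf gs : σ → σ → σ) (a : X ⊕ Fin 5) (l : List σ) : List σ :=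
  Sum.casesOn a (fun x => gv x :: l) fun i =>
    if i = 0 then go :: l
    else if i = 1 then gi l.headI :: l.tail
    else if i = 2 then gm l.headI l.tail.headI :: l.tail.tail
    else if i = 3 then gf l.headI l.tail.headI :: l.tail.tail
    else gs l.headI l.tail.headI :: l.tail.tail

theorem primrec_stackStep [Inhabited σ] {gv : X → σ} (go : σ) {gi : σ → σ}
    {gm gf gs : σ → σ → σ} (hv : Primrec gv) (hi : Primrec gi) (hm : Primrec₂ gm)
    (hf : Primrec₂ gf) (hs : Primrec₂ gs) : Primrec₂ (stackStep gv go gi gm gf gs) := by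
  have hl : Primrec fun q : ((X ⊕ Fin 5) × List σ) × Fin 5 => q.1.2 :=
    Primrec.snd.comp Primrec.fst
  have ht := Primrec.list_tail.comp hl
  have h1 := Primrec.list_headI.comp hl
  have h2 := Primrec.list_headI.comp ht
  have htt := Primrec.list_tail.comp ht
  have hc (k : Fin 5) : PrimrecPred fun q : ((X ⊕ Fin 5) × List σ) × Fin 5 => q.2 = k :=
    Primrec.eq.comp Primrec.snd (Primrec.const k)
  refine Primrec.sumCasesOn (f := fun q : (X ⊕ Fin 5) × List σ => q.1)
    (g := fun q x => gv x :: q.2) Primrec.fst ?_ ?_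
  · exact Primrec.list_cons.comp (hv.comp Primrec.snd) (Primrec.snd.comp Primrec.fst)
  · exact Primrec.ite (hc 0) (Primrec.list_cons.comp (Primrec.const go) hl) <|
      Primrec.ite (hc 1) (Primrec.list_cons.comp (hi.comp h1) ht) <|
      Primrec.ite (hc 2) (Primrec.list_cons.comp (hm.comp h1 h2) htt) <|
      Primrec.ite (hc 3) (Primrec.list_cons.comp (hf.comp h1 h2) htt)
        (Primrec.list_cons.comp (hs.comp h1 h2) htt)

/-- A function that is defined by structural recursion on terms from primitive recursive operations
is primitive recursive. -/
theorem primrec_of_recursion [Inhabited σ] {g : LTerm X → σ} {gv : X → σ} {go : σ} {gi : σ → σ}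
    {gm gf gs : σ → σ → σ} (hv : Primrec gv) (hi : Primrec gi) (hm : Primrec₂ gm)
    (hf : Primrec₂ gf) (hs : Primrec₂ gs) (ev : ∀ x, g (var x) = gv x) (eo : g one = go)
    (ei : ∀ s, g (inv s) = gi (g s)) (em : ∀ s t, g (mul s t) = gm (g s) (g t))
    (ef : ∀ s t, g (inf s t) = gf (g s) (g t)) (es : ∀ s t, g (sup s t) = gs (g s) (g t)) :
    Primrec g := by
  -- On the string of a term every operation symbol finds its arguments on the stack, so the default
  -- values of `headI` never matter.
  have key (t : LTerm X) : ∀ l : List σ,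
      t.toPolish.foldr (stackStep gv go gi gm gf gs) l = g t :: l := by
    induction t with
    | var x => intro l; simp [toPolish, stackStep, ev]
    | one => intro l; simp [toPolish, stackStep, eo]
    | inv s ih => intro l; simp [toPolish, stackStep, ih, ei]
    | mul s t ihs iht => intro l; simp [toPolish, stackStep, ihs, iht, em]
    | inf s t ihs iht => intro l; simp [toPolish, stackStep, ihs, iht, ef]
    | sup s t ihs iht => intro l; simp [toPolish, stackStep, ihs, iht, es]
  have h := Primrec.list_headI.comp (Primrec.list_foldr (α := LTerm X) (f := toPolish)
    (g := fun _ => []) (h := fun _ p => stackStep gv go gi gm gf gs p.1 p.2)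
    primrec_toPolish (Primrec.const [])
    ((primrec_stackStep go hv hi hm hf hs).comp₂ (Primrec.fst.comp₂ Primrec₂.right)
      (Primrec.snd.comp₂ Primrec₂.right)))
  exact h.of_eq fun t => by simp [key]

end Primrec

/-! ### Conjunctive normal forms -/

/-- The inverse of a group word; a word is a list of letters, and `(x, false)` stands for the
inverse of the variable `x`. -/
def invWord {X : Type u} (w : List (X × Bool)) : List (X × Bool) :=
  (w.map fun a => (a.1, !a.2)).reverse

/-- The pairwise products of the words in two clauses. -/
def mulClause {X : Type u} (a b : List (List (X × Bool))) : List (List (X × Bool)) :=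
  a.flatMap fun w => b.map fun w' => w ++ w'

/-- A meet of joins of group words that is equal to a term in all lattice-ordered groups. -/
def cnf {X : Type u} : LTerm X → List (List (List (X × Bool)))
  | var x => [[[(x, true)]]]
  | one => [[[]]]
  | inv s => s.cnf.sections.map fun a => a.map invWord
  | mul s t => s.cnf.flatMap fun a => t.cnf.map fun b => mulClause a b
  | inf s t => s.cnf ++ t.cnf
  | sup s t => s.cnf.flatMap fun a => t.cnf.map fun b => a ++ b

/-! ### Computability of the normal form. -/

section Primrec

variable {X : Type u} [Primcodable X]

theorem primrec_invWord : Primrec (invWord : List (X × Bool) → _) :=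
  Primrec.list_reverse.comp (Primrec.list_map Primrec.id
    (Primrec.pair (Primrec.fst.comp Primrec.snd) (Primrec.not.comp (Primrec.snd.comp Primrec.snd))))

theorem primrec_product {α β γ : Type*} [Primcodable α] [Primcodable β] [Primcodable γ]
    {f : α → β → γ} (hf : Primrec₂ f) :
    Primrec₂ fun (l : List α) (m : List β) => l.flatMap fun a => m.map (f a) := by
  refine Primrec.list_flatMap Primrec.fst (Primrec.list_map (Primrec.snd.comp Primrec.fst) ?_)
  exact hf.comp₂ (Primrec.snd.comp₂ Primrec₂.left) Primrec₂.right

theorem primrec_sections {α : Type*} [Primcodable α] :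
    Primrec (List.sections : List (List α) → List (List α)) := by
  have h : Primrec₂ fun (l : List α) (m : List (List α)) =>
      m.flatMap fun s => l.map fun a => a :: s :=
    (primrec_product (f := fun (s : List α) (a : α) => a :: s)
      (Primrec.list_cons.comp Primrec.snd Primrec.fst)).swap
  refine (Primrec.list_foldr (α := List (List α)) (f := id) (g := fun _ => [[]])
    (h := fun _ p => p.2.flatMap fun s => p.1.map fun a => a :: s) Primrec.id (Primrec.const _)
    (h.comp₂ (Primrec.fst.comp₂ Primrec₂.right) (Primrec.snd.comp₂ Primrec₂.right))).of_eq ?_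
  intro L
  induction L with
  | nil => rfl
  | cons l L ih => simp only [id, List.foldr_cons, List.sections] at ih ⊢; rw [ih]

theorem primrec_cnf : Primrec (cnf : LTerm X → _) := by
  refine primrec_of_recursion (gv := fun x => [[[(x, true)]]]) (go := [[[]]])
    (gi := fun s => s.sections.map fun a => a.map invWord)
    (gm := fun s t => s.flatMap fun a => t.map fun b => mulClause a b)
    (gf := fun s t => s ++ t) (gs := fun s t => s.flatMap fun a => t.map fun b => a ++ b)
    ?_ ?_ ?_ ?_ ?_ (fun _ => rfl) rfl (fun _ => rfl) (fun _ _ => rfl) (fun _ _ => rfl)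
    (fun _ _ => rfl)
  · have hs {α : Type _} [Primcodable α] : Primrec fun a : α => [a] :=
      Primrec.list_cons.comp Primrec.id (Primrec.const [])
    exact hs.comp (hs.comp (hs.comp (Primrec.pair Primrec.id (Primrec.const true))))
  · exact Primrec.list_map primrec_sections
      (Primrec.list_map Primrec.snd (primrec_invWord.comp Primrec.snd))
  · exact primrec_product (primrec_product Primrec.list_append)
  · exact Primrec.list_append
  · exact primrec_product Primrec.list_append

end Primrec

end LTerm

/-! ### The inverse-free equations of a clause -/

namespace LEquation

open LTerm

/-- The words of a clause, each followed by a separator, in one list. -/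
def tokens {X : Type u} (C : List (List (X × Bool))) : List (Option (X × Bool)) :=
  C.flatMap fun w => w.map some ++ [none]

/-- The pairs of words contributed by a token that is followed by `n` further tokens. The variables
`2 * k + 2` and `2 * k + 3` go with the suffix of length `k` of the list of tokens, and the
variables `0` and `1` go with the base point. -/
def tokenStep {X : Type u} (a : Option (X × Bool)) (n : ℕ) :
    List (List (X ⊕ ℕ) × List (X ⊕ ℕ)) :=
  Option.casesOn a
    [([Sum.inr 0, Sum.inr 1], [Sum.inr (2 * n + 4), Sum.inr 1]),
      ([Sum.inr (2 * n + 2), Sum.inr (2 * n + 5)], [Sum.inr 0, Sum.inr (2 * n + 5)])]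
    fun p => cond p.2
      [([Sum.inr (2 * n + 2), Sum.inr (2 * n + 5)],
        [Sum.inr (2 * n + 4), Sum.inl p.1, Sum.inr (2 * n + 5)])]
      [([Sum.inr (2 * n + 2), Sum.inl p.1, Sum.inr (2 * n + 5)],
        [Sum.inr (2 * n + 4), Sum.inr (2 * n + 5)])]

/-- The pairs of words contributed by a list of tokens. -/
def tokenPairs {X : Type u} : List (Option (X × Bool)) → List (List (X ⊕ ℕ) × List (X ⊕ ℕ))
  | [] => []
  | a :: T => tokenStep a T.length ++ tokenPairs T

/-- The product of a word as a term. -/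
def wordTerm {X : Type u} (w : List X) : LTerm X :=
  w.foldr (fun x t => mul (var x) t) one

/-- The meet of the words in a nonempty list. -/
def infTerm {X : Type u} (w : List X) (l : List (List X)) : LTerm X :=
  l.foldr (fun w t => inf (wordTerm w) t) (wordTerm w)

/-- The join of the words in a nonempty list. -/
def supTerm {X : Type u} (w : List X) (l : List (List X)) : LTerm X :=
  l.foldr (fun w t => sup (wordTerm w) t) (wordTerm w)

/-- The equation that expresses that a meet of words is below a join of words. -/
def wordInequality {X : Type u} (a : List X) (A : List (List X)) (b : List X)
    (B : List (List X)) : LEquation X :=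
  (inf (infTerm a A) (supTerm b B), infTerm a A)

/-- The inverse-free equation of a clause. -/
def clauseEquation {X : Type u} (C : List (List (X × Bool))) : LEquation (X ⊕ ℕ) :=
  wordInequality [Sum.inr 0, Sum.inr 1] ((tokenPairs (none :: tokens C)).map Prod.fst)
    [Sum.inr (2 * (tokens C).length + 4), Sum.inr 1]
    ((tokenPairs (none :: tokens C)).map Prod.snd)

/-- The clauses of the term `s⁻¹ t ∧ t⁻¹ s` of an equation `s ≈ t`. -/
def clauses {X : Type u} (ε : LEquation X) : List (List (List (X × Bool))) :=
  (inf (mul (inv ε.1) ε.2) (mul (inv ε.2) ε.1)).cnf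

/-- The construction of the inverse-free equations from an equation. -/
def eliminateInverses (X : Type u) (ε : LEquation X) : ℕ × List (LEquation (X ⊕ ℕ)) :=
  (ε.clauses.foldr (fun C n => 2 * (tokens C).length + 6 + n) 0, ε.clauses.map clauseEquation)

/-! ### Computability of the construction. -/

section Primrec

variable {X : Type u} [Primcodable X]

theorem primrec_tokens : Primrec (tokens : List (List (X × Bool)) → _) :=
  Primrec.list_flatMap Primrec.id (Primrec.list_append.comp
    (Primrec.list_map Primrec.snd (Primrec.option_some.comp Primrec.snd)) (Primrec.const _))

theorem primrec_two_mul_add (k : ℕ) : Primrec fun n => 2 * n + k :=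
  Primrec.nat_add.comp (Primrec.nat_mul.comp (Primrec.const 2) Primrec.id) (Primrec.const k)

theorem primrec_tokenStep : Primrec₂ (tokenStep : Option (X × Bool) → ℕ → _) := by
  have single {α β : Type _} [Primcodable α] [Primcodable β] {f : α → β} (hf : Primrec f) :
      Primrec fun a => [f a] := Primrec.list_cons.comp hf (Primrec.const [])
  have cons {α β : Type _} [Primcodable α] [Primcodable β] {f : α → β} {g : α → List β}
      (hf : Primrec f) (hg : Primrec g) : Primrec fun a => f a :: g a :=
    Primrec.list_cons.comp hf hg
  have v {α : Type _} [Primcodable α] {f : α → ℕ} (hf : Primrec f) (k : ℕ) :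
      Primrec fun a => (Sum.inr (2 * f a + k) : X ⊕ ℕ) :=
    Primrec.sumInr.comp ((primrec_two_mul_add k).comp hf)
  have c {α : Type _} [Primcodable α] (k : ℕ) : Primrec fun _ : α => (Sum.inr k : X ⊕ ℕ) :=
    Primrec.const _
  refine Primrec.option_casesOn Primrec.fst ?_ (Primrec.cond ?_ ?_ ?_)
  · have n : Primrec fun q : Option (X × Bool) × ℕ => q.2 := Primrec.snd
    exact cons (Primrec.pair (Primrec.const _) (cons (v n 4) (single (c 1))))
      (single (Primrec.pair (cons (v n 2) (single (v n 5))) (cons (c 0) (single (v n 5)))))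
  · exact Primrec.snd.comp Primrec.snd
  all_goals
    have n : Primrec fun q : (Option (X × Bool) × ℕ) × X × Bool => q.1.2 :=
      Primrec.snd.comp Primrec.fst
    have x : Primrec fun q : (Option (X × Bool) × ℕ) × X × Bool => (Sum.inl q.2.1 : X ⊕ ℕ) :=
      Primrec.sumInl.comp (Primrec.fst.comp Primrec.snd)
  · exact single (Primrec.pair (cons (v n 2) (single (v n 5)))
      (cons (v n 4) (cons x (single (v n 5)))))
  · exact single (Primrec.pair (cons (v n 2) (cons x (single (v n 5))))
      (cons (v n 4) (single (v n 5))))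

theorem primrec_tokenPairs : Primrec (tokenPairs : List (Option (X × Bool)) → _) := by
  refine (Primrec.list_rec (α := List (Option (X × Bool))) (f := id) (g := fun _ => [])
    (h := fun _ p => tokenStep p.1 p.2.1.length ++ p.2.2) Primrec.id (Primrec.const _) ?_).of_eq ?_
  · exact Primrec.list_append.comp
      (primrec_tokenStep.comp (Primrec.fst.comp Primrec.snd)
        (Primrec.list_length.comp (Primrec.fst.comp (Primrec.snd.comp Primrec.snd))))
      (Primrec.snd.comp (Primrec.snd.comp Primrec.snd))
  · intro T
    induction T with
    | nil => rfl
    | cons a T ih => simp only [id, tokenPairs] at ih ⊢; rw [ih]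

theorem primrec_wordTerm : Primrec (wordTerm : List X → LTerm X) :=
  Primrec.list_foldr (f := id) (g := fun _ => one) (h := fun _ p => mul (var p.1) p.2) Primrec.id
    (Primrec.const _) (primrec_mul.comp₂ ((primrec_var.comp Primrec.fst).comp₂ Primrec₂.right)
      (Primrec.snd.comp₂ Primrec₂.right))

theorem primrec_infTerm : Primrec₂ (infTerm : List X → List (List X) → LTerm X) :=
  Primrec.list_foldr (f := Prod.snd) (g := fun q => wordTerm q.1)
    (h := fun _ p => inf (wordTerm p.1) p.2) Primrec.snd (primrec_wordTerm.comp Primrec.fst)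
    (primrec_inf.comp₂ ((primrec_wordTerm.comp Primrec.fst).comp₂ Primrec₂.right)
      (Primrec.snd.comp₂ Primrec₂.right))

theorem primrec_supTerm : Primrec₂ (supTerm : List X → List (List X) → LTerm X) :=
  Primrec.list_foldr (f := Prod.snd) (g := fun q => wordTerm q.1)
    (h := fun _ p => sup (wordTerm p.1) p.2) Primrec.snd (primrec_wordTerm.comp Primrec.fst)
    (primrec_sup.comp₂ ((primrec_wordTerm.comp Primrec.fst).comp₂ Primrec₂.right)
      (Primrec.snd.comp₂ Primrec₂.right))

theorem primrec_clauseEquation :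
    Primrec (clauseEquation : List (List (X × Bool)) → LEquation (X ⊕ ℕ)) := by
  have hT : Primrec fun C : List (List (X × Bool)) => tokenPairs (none :: tokens C) :=
    primrec_tokenPairs.comp (Primrec.list_cons.comp (Primrec.const _) primrec_tokens)
  have hA : Primrec fun C : List (List (X × Bool)) =>
      infTerm [Sum.inr 0, Sum.inr 1] ((tokenPairs (none :: tokens C)).map Prod.fst) :=
    primrec_infTerm.comp (Primrec.const _)
      (Primrec.list_map hT (Primrec.fst.comp₂ Primrec₂.right))
  have hB : Primrec fun C : List (List (X × Bool)) =>
      supTerm [Sum.inr (2 * (tokens C).length + 4), Sum.inr 1]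
        ((tokenPairs (none :: tokens C)).map Prod.snd) :=
    primrec_supTerm.comp
      (Primrec.list_cons.comp
        (Primrec.sumInr.comp ((primrec_two_mul_add 4).comp
          (Primrec.list_length.comp primrec_tokens))) (Primrec.const _))
      (Primrec.list_map hT (Primrec.snd.comp₂ Primrec₂.right))
  exact Primrec.pair (primrec_inf.comp hA hB) hA

theorem primrec_clauses : Primrec (clauses : LEquation X → _) :=
  primrec_cnf.comp (primrec_inf.comp
    (primrec_mul.comp (primrec_inv.comp Primrec.fst) Primrec.snd)
    (primrec_mul.comp (primrec_inv.comp Primrec.snd) Primrec.fst))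

theorem primrec_eliminateInverses : Primrec (eliminateInverses X) := by
  refine Primrec.pair (Primrec.list_foldr (h := fun _ p => 2 * (tokens p.1).length + 6 + p.2)
    primrec_clauses (Primrec.const 0) ?_)
    (Primrec.list_map primrec_clauses (primrec_clauseEquation.comp Primrec.snd))
  exact Primrec.nat_add.comp ((primrec_two_mul_add 6).comp (Primrec.list_length.comp
    (primrec_tokens.comp (Primrec.fst.comp Primrec.snd)))) (Primrec.snd.comp Primrec.snd)

end Primrec

end LEquation

/-! ### Renaming of variables -/

section Rename

variable {X Z : Type u} (e : X → Z)

theorem List.sections_map_map {α β : Type*} (f : α → β) (L : List (List α)) :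
    (L.map (List.map f)).sections = L.sections.map (List.map f) := by
  induction L with
  | nil => rfl
  | cons l L ih =>
    simp only [List.map_cons, List.sections, ih, List.flatMap_map, List.map_flatMap, List.map_map]
    rfl

namespace LTerm

theorem invWord_map (w : List (X × Bool)) :
    invWord (w.map (Prod.map e id)) = (invWord w).map (Prod.map e id) := by
  simp [invWord, Function.comp_def]

theorem mulClause_map (a b : List (List (X × Bool))) :
    mulClause (a.map (List.map (Prod.map e id))) (b.map (List.map (Prod.map e id))) =
      (mulClause a b).map (List.map (Prod.map e id)) := by
  simp [mulClause, List.flatMap_map, List.map_flatMap, Function.comp_def]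

theorem cnf_rename (t : LTerm X) :
    (t.rename e).cnf = t.cnf.map (List.map (List.map (Prod.map e id))) := by
  induction t with
  | var x => rfl
  | one => rfl
  | inv s ih =>
    simp only [rename, cnf, ih, List.sections_map_map, List.map_map]
    congr 1
    funext a
    simp [invWord_map, Function.comp_def]
  | mul s t ihs iht =>
    simp [rename, cnf, ihs, iht, List.flatMap_map, List.map_flatMap, Function.comp_def,
      mulClause_map]
  | inf s t ihs iht => simp [rename, cnf, ihs, iht]
  | sup s t ihs iht =>
    simp [rename, cnf, ihs, iht, List.flatMap_map, List.map_flatMap, Function.comp_def]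

end LTerm

namespace LEquation

theorem tokens_map (C : List (List (X × Bool))) :
    tokens (C.map (List.map (Prod.map e id))) = (tokens C).map (Option.map (Prod.map e id)) := by
  simp [tokens, List.flatMap_map, List.map_flatMap, Function.comp_def]

theorem tokenStep_map (a : Option (X × Bool)) (n : ℕ) :
    tokenStep (a.map (Prod.map e id)) n = (tokenStep a n).map
      (Prod.map (List.map (Sum.map e id)) (List.map (Sum.map e id))) := by
  rcases a with _ | ⟨x, _ | _⟩ <;> rfl

theorem tokenPairs_map (T : List (Option (X × Bool))) :
    tokenPairs (T.map (Option.map (Prod.map e id))) = (tokenPairs T).map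
      (Prod.map (List.map (Sum.map e id)) (List.map (Sum.map e id))) := by
  induction T with
  | nil => rfl
  | cons a T ih => simp [tokenPairs, ih, tokenStep_map]

theorem wordTerm_map (w : List X) : wordTerm (w.map e) = (wordTerm w).rename e := by
  induction w with
  | nil => rfl
  | cons x w ih => exact congrArg (LTerm.mul (LTerm.var (e x))) ih

theorem infTerm_map (w : List X) (l : List (List X)) :
    infTerm (w.map e) (l.map (List.map e)) = (infTerm w l).rename e := by
  induction l with
  | nil => exact wordTerm_map e w
  | cons a l ih => exact congrArg₂ LTerm.inf (wordTerm_map e a) ih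

theorem supTerm_map (w : List X) (l : List (List X)) :
    supTerm (w.map e) (l.map (List.map e)) = (supTerm w l).rename e := by
  induction l with
  | nil => exact wordTerm_map e w
  | cons a l ih => exact congrArg₂ LTerm.sup (wordTerm_map e a) ih

theorem wordInequality_map (a : List X) (A : List (List X)) (b : List X) (B : List (List X)) :
    wordInequality (a.map e) (A.map (List.map e)) (b.map e) (B.map (List.map e)) =
      (wordInequality a A b B).rename e := by
  simp only [wordInequality, infTerm_map, supTerm_map]
  rfl

theorem clauseEquation_map (C : List (List (X × Bool))) :
    clauseEquation (C.map (List.map (Prod.map e id))) =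
      (clauseEquation C).rename (Sum.map e id) := by
  rw [clauseEquation, clauseEquation, ← wordInequality_map, tokens_map]
  have h := tokenPairs_map e (none :: tokens C)
  simp only [List.map_cons, Option.map_none] at h
  simp [h, Function.comp_def]

/-- Every stage is built from list operations natural in the set of variables, and the indices of
the fresh variables depend only on lengths. -/
theorem eliminateInverses_rename (ε : LEquation X) :
    eliminateInverses Z (ε.rename e) = ((eliminateInverses X ε).1,
      (eliminateInverses X ε).2.map (LEquation.rename (Sum.map e id))) := by
  have h : (ε.rename e).clauses = ε.clauses.map (List.map (List.map (Prod.map e id))) :=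
    LTerm.cnf_rename e (LTerm.inf (LTerm.mul (LTerm.inv ε.1) ε.2) (LTerm.mul (LTerm.inv ε.2) ε.1))
  simp [eliminateInverses, h, List.foldr_map, tokens_map, clauseEquation_map, Function.comp_def]

end LEquation

end Rename

/-! ### Inverse-free terms and their variables -/

namespace LEquation

open LTerm

variable {X : Type u}

theorem inverseFree_wordTerm (w : List X) : (wordTerm w).InverseFree := by
  induction w with
  | nil => trivial
  | cons x w ih => exact ⟨trivial, ih⟩

theorem inverseFree_infTerm (w : List X) (l : List (List X)) : (infTerm w l).InverseFree := by
  induction l with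
  | nil => exact inverseFree_wordTerm w
  | cons a l ih => exact ⟨inverseFree_wordTerm a, ih⟩

theorem inverseFree_supTerm (w : List X) (l : List (List X)) : (supTerm w l).InverseFree := by
  induction l with
  | nil => exact inverseFree_wordTerm w
  | cons a l ih => exact ⟨inverseFree_wordTerm a, ih⟩

theorem inverseFree_wordInequality (a : List X) (A : List (List X)) (b : List X)
    (B : List (List X)) : (wordInequality a A b B).InverseFree :=
  ⟨⟨inverseFree_infTerm a A, inverseFree_supTerm b B⟩, inverseFree_infTerm a A⟩

theorem mem_vars_wordTerm {w : List X} {x : X} (h : x ∈ (wordTerm w).vars) : x ∈ w := by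
  induction w with
  | nil => exact h.elim
  | cons y w ih =>
    rcases h with h | h
    · exact List.mem_cons.2 (Or.inl h)
    · exact List.mem_cons_of_mem _ (ih h)

theorem mem_vars_infTerm {w : List X} {l : List (List X)} {x : X} (h : x ∈ (infTerm w l).vars) :
    ∃ a ∈ w :: l, x ∈ a := by
  induction l with
  | nil => exact ⟨w, by simp, mem_vars_wordTerm h⟩
  | cons a l ih =>
    rcases h with h | h
    · exact ⟨a, by simp, mem_vars_wordTerm h⟩
    · obtain ⟨b, hb, hx⟩ := ih h
      exact ⟨b, by simp only [List.mem_cons] at hb ⊢; tauto, hx⟩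

theorem mem_vars_supTerm {w : List X} {l : List (List X)} {x : X} (h : x ∈ (supTerm w l).vars) :
    ∃ a ∈ w :: l, x ∈ a := by
  induction l with
  | nil => exact ⟨w, by simp, mem_vars_wordTerm h⟩
  | cons a l ih =>
    rcases h with h | h
    · exact ⟨a, by simp, mem_vars_wordTerm h⟩
    · obtain ⟨b, hb, hx⟩ := ih h
      exact ⟨b, by simp only [List.mem_cons] at hb ⊢; tauto, hx⟩

/-- The suffix of length `k` owns the indices `2 * k + 2` and `2 * k + 3`, and the longest suffix is
`T` itself. With the leading separator of a clause the constant 4 becomes 6. -/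
theorem lt_of_mem_tokenPairs {T : List (Option (X × Bool))} {p : List (X ⊕ ℕ) × List (X ⊕ ℕ)}
    (hp : p ∈ tokenPairs T) {i : ℕ} (hi : Sum.inr i ∈ p.1 ∨ Sum.inr i ∈ p.2) :
    i < 2 * T.length + 4 := by
  induction T with
  | nil => simp [tokenPairs] at hp
  | cons a T ih =>
    rcases List.mem_append.1 hp with h | h
    · rcases a with _ | ⟨x, _ | _⟩ <;> simp [tokenStep] at h
      · rcases h with rfl | rfl <;> simp at hi ⊢ <;> omega
      · subst h; simp at hi ⊢; omega
      · subst h; simp at hi ⊢; omega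
    · have := ih h
      simp only [List.length_cons]
      omega

theorem lt_of_mem_vars_clauseEquation {C : List (List (X × Bool))} {i : ℕ}
    (hi : Sum.inr i ∈ (clauseEquation C).vars) : i < 2 * (tokens C).length + 6 := by
  have hA : Sum.inr i ∈ (infTerm [Sum.inr 0, Sum.inr 1]
      ((tokenPairs (none :: tokens C)).map Prod.fst)).vars → i < 2 * (tokens C).length + 6 := by
    intro h
    obtain ⟨a, ha, hx⟩ := mem_vars_infTerm h
    rcases List.mem_cons.1 ha with rfl | ha
    · simp at hx; omega
    · obtain ⟨p, hp, rfl⟩ := List.mem_map.1 ha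
      have := lt_of_mem_tokenPairs hp (Or.inl hx)
      simp at this; omega
  rcases hi with (hi | hi) | hi
  · exact hA hi
  · obtain ⟨a, ha, hx⟩ := mem_vars_supTerm hi
    rcases List.mem_cons.1 ha with rfl | ha
    · simp at hx; omega
    · obtain ⟨p, hp, rfl⟩ := List.mem_map.1 ha
      have := lt_of_mem_tokenPairs hp (Or.inr hx)
      simp at this; omega
  · exact hA hi

/-- The clauses share their fresh variables; the sum of the bounds is a crude substitute for the
maximum. -/
theorem lt_of_mem_vars_eliminateInverses {ε : LEquation X} {σ : LEquation (X ⊕ ℕ)}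
    (hσ : σ ∈ (eliminateInverses X ε).2) {i : ℕ} (hi : Sum.inr i ∈ σ.vars) :
    i < (eliminateInverses X ε).1 := by
  obtain ⟨C, hC, rfl⟩ := List.mem_map.1 hσ
  refine (lt_of_mem_vars_clauseEquation hi).trans_le ?_
  change _ ≤ List.foldr _ _ _
  generalize ε.clauses = L at hC ⊢
  induction L with
  | nil => simp at hC
  | cons D L ih =>
    rw [List.foldr_cons]
    rcases List.mem_cons.1 hC with rfl | h
    · omega
    · have := ih h
      omega

end LEquation

/-! ### Lattice actions on chains -/

/-- An action of a lattice-ordered monoid on a chain by order-preserving maps, such that meets and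
joins are computed pointwise. -/
structure IsLatticeAction {M Ω : Type*} [Monoid M] [Lattice M] [LinearOrder Ω]
    (act : M → Ω → Ω) : Prop where
  one_act : ∀ p, act 1 p = p
  mul_act : ∀ g h p, act (g * h) p = act g (act h p)
  mono : ∀ g, Monotone (act g)
  inf_act : ∀ g h p, act (g ⊓ h) p = act g p ⊓ act h p
  sup_act : ∀ g h p, act (g ⊔ h) p = act g p ⊔ act h p

/-! ### Representation of distributive ℓ-monoids by prime ideals. -/

namespace DistribLMonoid

variable {M : Type*} [DistribLMonoid M]

theorem mul_inf' (a b c : M) : a * (b ⊓ c) = a * b ⊓ a * c := by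
  simpa using mul_inf_mul a b c 1

theorem mul_sup' (a b c : M) : a * (b ⊔ c) = a * b ⊔ a * c := by
  simpa using mul_sup_mul a b c 1

theorem inf_mul' (a b c : M) : (a ⊓ b) * c = a * c ⊓ b * c := by
  simpa using mul_inf_mul 1 a b c

theorem sup_mul' (a b c : M) : (a ⊔ b) * c = a * c ⊔ b * c := by
  simpa using mul_sup_mul 1 a b c

/-- The translates of the complement of `J` by an element of `M`. -/
def translate (J : Set M) (g : M) : Set M := {u | u * g ∉ J}

/-- Witnesses `u`, `v` against both inclusions satisfy `u * g ⊓ v * h ≤ u * h ⊔ v * g`. The right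
side lies in `J`, so by primeness `u * g` or `v * h` does too. -/
theorem translate_total {J : Order.Ideal M} (hJ : J.IsPrime) (g h : M) :
    translate (J : Set M) g ⊆ translate (J : Set M) h ∨
      translate (J : Set M) h ⊆ translate (J : Set M) g := by
  by_contra! H
  obtain ⟨u, hug, huh⟩ := Set.not_subset.1 H.1
  obtain ⟨v, hvh, hvg⟩ := Set.not_subset.1 H.2
  have huh' : u * h ∈ J := not_not.1 huh
  have hvg' : v * g ∈ J := not_not.1 hvg
  have h1 : u * g ⊓ v * h ≤ u * h ⊔ v * g :=
    calc u * g ⊓ v * h ≤ (u ⊔ v) * g ⊓ (u ⊔ v) * h := by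
          rw [sup_mul', sup_mul']
          exact inf_le_inf le_sup_left le_sup_right
      _ = u * (g ⊓ h) ⊔ v * (g ⊓ h) := by rw [← mul_inf', sup_mul']
      _ ≤ u * h ⊔ v * g := by
          rw [mul_inf', mul_inf']
          exact sup_le_sup inf_le_right inf_le_left
  rcases hJ.mem_or_mem (J.lower h1 (Order.Ideal.sup_mem huh' hvg')) with h2 | h2
  · exact hug h2
  · exact hvh h2

/-- A distributive lattice-ordered monoid acts on a chain, and two elements of the monoid can be
distinguished in this way. -/
theorem exists_isLatticeAction {M : Type w} [DistribLMonoid M] {a b : M} (hab : ¬ a ≤ b) :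
    ∃ (Ω : Type w) (_ : LinearOrder Ω) (act : M → Ω → Ω),
      IsLatticeAction act ∧ ∃ p, act b p < act a p := by
  classical
  obtain ⟨J, hJ, hbJ, haJ⟩ := DistribLattice.prime_ideal_of_disjoint_filter_ideal
    (F := Order.PFilter.principal a) (I := Order.Ideal.principal b) (by
      rw [Set.disjoint_left]
      intro x hx hx'
      exact hab (le_trans hx hx'))
  have hb : b ∈ J := hbJ (Order.Ideal.mem_principal_self)
  have ha : a ∉ J := Set.disjoint_left.1 haJ (le_refl a)
  let Ω := Set.range (translate (J : Set M))
  let ord : LinearOrder Ω :=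
    { (inferInstance : PartialOrder Ω) with
      le_total := by
        rintro ⟨_, g, rfl⟩ ⟨_, h, rfl⟩
        exact translate_total hJ g h
      toDecidableLE := Classical.decRel _ }
  have coe_inf (p q : Ω) : ((p ⊓ q : Ω) : Set M) = (p : Set M) ∩ (q : Set M) := by
    rcases le_total p q with h | h
    · rw [inf_eq_left.2 h, Set.inter_eq_left.2 h]
    · rw [inf_eq_right.2 h, Set.inter_eq_right.2 h]
  have coe_sup (p q : Ω) : ((p ⊔ q : Ω) : Set M) = (p : Set M) ∪ (q : Set M) := by
    rcases le_total p q with h | h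
    · rw [sup_eq_right.2 h, Set.union_eq_right.2 h]
    · rw [sup_eq_left.2 h, Set.union_eq_left.2 h]
  have translate_mul (g h : M) : {u | u * g ∈ translate (J : Set M) h} = translate J (g * h) := by
    ext u
    simp [translate, mul_assoc]
  -- This sends the translate by `h` to the translate by `g * h`, hence is a left action.
  let act (g : M) (p : Ω) : Ω := ⟨{u | u * g ∈ (p : Set M)}, by
    obtain ⟨_, h, rfl⟩ := p
    exact ⟨g * h, (translate_mul g h).symm⟩⟩
  refine ⟨Ω, ord, act, ⟨?_, ?_, ?_, ?_, ?_⟩, ⟨_, 1, rfl⟩, lt_of_not_ge fun h => ?_⟩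
  · intro p
    apply Subtype.ext
    simp [act]
  · intro g h p
    apply Subtype.ext
    simp [act, mul_assoc]
  · intro g p q hpq u hu
    exact hpq hu
  · rintro g h ⟨_, k, rfl⟩
    apply Subtype.ext
    rw [coe_inf]
    ext u
    change ¬ (u * (g ⊓ h) * k ∈ J) ↔ ¬ (u * g * k ∈ J) ∧ ¬ (u * h * k ∈ J)
    rw [mul_inf', inf_mul', ← not_or]
    exact not_congr ⟨hJ.mem_or_mem, fun H => H.elim (J.lower inf_le_left) (J.lower inf_le_right)⟩
  · rintro g h ⟨_, k, rfl⟩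
    apply Subtype.ext
    rw [coe_sup]
    ext u
    change ¬ (u * (g ⊔ h) * k ∈ J) ↔ ¬ (u * g * k ∈ J) ∨ ¬ (u * h * k ∈ J)
    rw [mul_sup', sup_mul', ← not_and_or, Order.Ideal.sup_mem_iff]
  -- At the translate by 1, the element 1 belongs to the image under `a` but not to that under `b`.
  · have h1 : ¬ (1 * a * 1 ∈ J) := by simpa using ha
    have h2 : ¬ (1 * b * 1 ∈ J) := h h1
    exact h2 (by simpa using hb)

/-- A lattice-ordered group is a distributive lattice-ordered monoid. -/
abbrev ofGroup (G : Type*) [hG : Group G] [hL : Lattice G] [MulLeftMono G] [MulRightMono G] :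
    DistribLMonoid G :=
  have sup_le_of (a b c : G) : a ⊓ (b ⊔ c) ≤ (a ⊓ b) ⊔ (a ⊓ c) := by
    -- The translation taking `b ⊔ c` to `a ⊓ (b ⊔ c)` preserves joins; it moves everything down,
    -- and everything below `b ⊔ c` to below `a`.
    have key (d : G) (hd : d ≤ b ⊔ c) : (a ⊓ (b ⊔ c)) * (b ⊔ c)⁻¹ * d ≤ a ⊓ d := by
      have h1 : (b ⊔ c)⁻¹ * d ≤ 1 := by
        simpa using mul_le_mul_right hd (b ⊔ c)⁻¹
      refine le_inf ?_ ?_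
      · rw [mul_assoc]
        simpa using mul_le_mul' (inf_le_left : a ⊓ (b ⊔ c) ≤ a) h1
      · rw [mul_assoc]
        simpa using mul_le_mul' (inf_le_right : a ⊓ (b ⊔ c) ≤ b ⊔ c) (le_refl ((b ⊔ c)⁻¹ * d))
    calc a ⊓ (b ⊔ c) = (a ⊓ (b ⊔ c)) * (b ⊔ c)⁻¹ * (b ⊔ c) := by simp
      _ = (a ⊓ (b ⊔ c)) * (b ⊔ c)⁻¹ * b ⊔ (a ⊓ (b ⊔ c)) * (b ⊔ c)⁻¹ * c := mul_sup _ _ _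
      _ ≤ (a ⊓ b) ⊔ (a ⊓ c) := sup_le_sup (key b le_sup_left) (key c le_sup_right)
  { hG.toMonoid, @DistribLattice.ofInfSupLe G hL sup_le_of with
    mul_sup_mul := fun a b c d => by rw [mul_sup, sup_mul]
    mul_inf_mul := fun a b c d => by rw [mul_inf, inf_mul] }

/-- The order-preserving maps of a chain form a distributive lattice-ordered monoid. -/
instance instOrderHom (Ω : Type*) [LinearOrder Ω] : DistribLMonoid (Ω →o Ω) :=
  { (inferInstance : Monoid (Ω →o Ω)), (inferInstance : Lattice (Ω →o Ω)) with
    le_sup_inf := fun f g h x => (le_sup_inf : (f x ⊔ g x) ⊓ (f x ⊔ h x) ≤ f x ⊔ g x ⊓ h x)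
    mul_sup_mul := fun f g h k => OrderHom.ext _ _ <| funext fun x =>
      f.monotone.map_sup (g (k x)) (h (k x))
    mul_inf_mul := fun f g h k => OrderHom.ext _ _ <| funext fun x =>
      f.monotone.map_inf (g (k x)) (h (k x)) }

theorem isLatticeAction_orderHom (Ω : Type*) [LinearOrder Ω] :
    IsLatticeAction fun (f : Ω →o Ω) x => f x :=
  ⟨fun _ => rfl, fun _ _ _ => rfl, fun f => f.monotone, fun _ _ _ => rfl, fun _ _ _ => rfl⟩

end DistribLMonoid

/-! ### The lattice-ordered group of automorphisms of a chain -/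

namespace ChainAut

variable {Ω : Type*} [LinearOrder Ω]

instance instPartialOrder : PartialOrder (Ω ≃o Ω) :=
  PartialOrder.lift (fun f : Ω ≃o Ω => (f : Ω → Ω)) DFunLike.coe_injective

/-- The pointwise maximum of two automorphisms. -/
def supIso (f g : Ω ≃o Ω) : Ω ≃o Ω :=
  StrictMono.orderIsoOfRightInverse (fun x => max (f x) (g x))
    (fun _ _ h => max_lt_max (f.strictMono h) (g.strictMono h))
    -- The inverse of a pointwise maximum is the pointwise minimum of the inverses.
    (fun x => f.symm x ⊓ g.symm x) fun x => by
      rcases le_total (f.symm x) (g.symm x) with h | h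
      · have : g (f.symm x) ≤ x := by simpa using g.monotone h
        simp [h, this]
      · have : f (g.symm x) ≤ x := by simpa using f.monotone h
        simp [h, this]

/-- The pointwise minimum of two automorphisms. -/
def infIso (f g : Ω ≃o Ω) : Ω ≃o Ω :=
  StrictMono.orderIsoOfRightInverse (fun x => min (f x) (g x))
    (fun _ _ h => min_lt_min (f.strictMono h) (g.strictMono h))
    (fun x => f.symm x ⊔ g.symm x) fun x => by
      rcases le_total (f.symm x) (g.symm x) with h | h
      · have : x ≤ f (g.symm x) := by simpa using f.monotone h
        simp [h, this]
      · have : x ≤ g (f.symm x) := by simpa using g.monotone h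
        simp [h, this]

instance instLattice : Lattice (Ω ≃o Ω) :=
  { instPartialOrder with
    sup := supIso
    inf := infIso
    le_sup_left := fun f g x => le_max_left (f x) (g x)
    le_sup_right := fun f g x => le_max_right (f x) (g x)
    sup_le := fun _ _ _ hf hg x => max_le (hf x) (hg x)
    inf_le_left := fun f g x => min_le_left (f x) (g x)
    inf_le_right := fun f g x => min_le_right (f x) (g x)
    le_inf := fun _ _ _ hf hg x => le_min (hf x) (hg x) }

instance instMulLeftMono : MulLeftMono (Ω ≃o Ω) :=
  ⟨fun f _ _ h x => f.monotone (h x)⟩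

instance instMulRightMono : MulRightMono (Ω ≃o Ω) :=
  ⟨fun f _ _ h x => h (f x)⟩

theorem isLatticeAction : IsLatticeAction fun (f : Ω ≃o Ω) x => f x :=
  ⟨fun _ => rfl, fun _ _ _ => rfl, fun f => f.monotone, fun _ _ _ => rfl, fun _ _ _ => rfl⟩

end ChainAut

/-! ### Words and terms acting on a chain -/

section Sections

variable {α : Type*} {L : List (List α)}

/-- Together with the next lemma this is the distributive law that turns a join of meets into a meet
of joins over choice functions, as needed for inverses in `cnf_spec`. -/
theorem List.exists_mem_sections {P : α → Prop} (h : ∀ l ∈ L, ∃ a ∈ l, P a) :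
    ∃ f ∈ L.sections, ∀ a ∈ f, P a := by
  induction L with
  | nil => exact ⟨[], by simp [List.sections], by simp⟩
  | cons l L ih =>
    obtain ⟨f, hf, hf'⟩ := ih fun m hm => h m (List.mem_cons_of_mem _ hm)
    obtain ⟨a, ha, ha'⟩ := h l List.mem_cons_self
    exact ⟨a :: f, List.mem_sections.2 (.cons ha (List.mem_sections.1 hf)), by simpa using ⟨ha', hf'⟩⟩

theorem List.exists_mem_of_mem_sections {f l : List α} (hf : f ∈ L.sections) (hl : l ∈ L) :
    ∃ a ∈ f, a ∈ l := by
  have hf := List.mem_sections.1 hf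
  induction hf with
  | nil => simp at hl
  | cons hab _ ih =>
    rcases List.mem_cons.1 hl with rfl | hl
    · exact ⟨_, List.mem_cons_self, hab⟩
    · obtain ⟨a, ha, hal⟩ := ih (List.mem_sections.2 ‹_›) hl
      exact ⟨a, List.mem_cons_of_mem _ ha, hal⟩

end Sections

section Word

variable {X : Type u} {M Ω : Type*}

/-- The action of a word on a chain; the last letter acts first. -/
def wordAct (f : X → Ω → Ω) (w : List X) (p : Ω) : Ω :=
  w.foldr f p

/-- The value of a letter of a group word. -/
def letterVal {G : Type*} [Group G] (v : X → G) (a : X × Bool) : G :=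
  cond a.2 (v a.1) (v a.1)⁻¹

theorem wordAct_append (f : X → Ω → Ω) (w w' : List X) (p : Ω) :
    wordAct f (w ++ w') p = wordAct f w (wordAct f w' p) :=
  List.foldr_append

namespace IsLatticeAction

variable [LinearOrder Ω]

/-! ### Group words and normal forms on a chain. -/

section Group

variable {G : Type*} [Group G] [Lattice G] {act : G → Ω → Ω}

theorem inv_act_act (h : IsLatticeAction act) (g : G) (p : Ω) : act g⁻¹ (act g p) = p := by
  rw [← h.mul_act, inv_mul_cancel, h.one_act]

theorem act_inv_act (h : IsLatticeAction act) (g : G) (p : Ω) : act g (act g⁻¹ p) = p := by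
  rw [← h.mul_act, mul_inv_cancel, h.one_act]

theorem strictMono (h : IsLatticeAction act) (g : G) : StrictMono (act g) :=
  (h.mono g).strictMono_of_injective fun p q hpq => by
    rw [← h.inv_act_act g p, ← h.inv_act_act g q, hpq]

theorem wordAct_mono (h : IsLatticeAction act) (v : X → G) (w : List (X × Bool)) :
    Monotone (wordAct (fun a => act (letterVal v a)) w) := by
  induction w with
  | nil => exact monotone_id
  | cons a w ih => exact (h.mono _).comp ih

theorem wordAct_invWord (h : IsLatticeAction act) (v : X → G) (w : List (X × Bool)) (p : Ω) :
    wordAct (fun a => act (letterVal v a)) (LTerm.invWord w)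
      (wordAct (fun a => act (letterVal v a)) w p) = p := by
  induction w with
  | nil => rfl
  | cons a w ih =>
    have h1 : LTerm.invWord (a :: w) = LTerm.invWord w ++ [(a.1, !a.2)] := by
      simp [LTerm.invWord]
    have h2 (q : Ω) : act (letterVal v (a.1, !a.2)) (act (letterVal v a) q) = q := by
      rcases a with ⟨x, _ | _⟩
      · exact h.act_inv_act _ _
      · exact h.inv_act_act _ _
    rw [h1, wordAct_append]
    exact (congrArg _ (h2 _)).trans ih

/-- A term acts on each point as the minimum over the clauses of the maximum over the words. -/
theorem cnf_spec (h : IsLatticeAction act) (v : X → G) (t : LTerm X) (p : Ω) :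
    (∀ C ∈ t.cnf, ∃ w ∈ C, act (t.eval v) p ≤ wordAct (fun a => act (letterVal v a)) w p) ∧
      ∃ C ∈ t.cnf, ∀ w ∈ C, wordAct (fun a => act (letterVal v a)) w p ≤ act (t.eval v) p := by
  induction t generalizing p with
  | var x => simp [LTerm.cnf, LTerm.eval, wordAct, letterVal]
  | one => simp [LTerm.cnf, LTerm.eval, wordAct, h.one_act]
  | inv s ih =>
    -- At this point `s` takes the value `p`. Inverting words reverses the bounds, so the roles of
    -- minimum and maximum are exchanged.
    obtain ⟨h1, C₀, hC₀, h2⟩ := ih (act (s.eval v)⁻¹ p)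
    rw [h.act_inv_act] at h1 h2
    have hinv (w : List (X × Bool)) (q r : Ω) :
        wordAct (fun a => act (letterVal v a)) w q ≤ r →
          q ≤ wordAct (fun a => act (letterVal v a)) (LTerm.invWord w) r := fun H => by
      simpa only [h.wordAct_invWord] using h.wordAct_mono v (LTerm.invWord w) H
    have hinv' (w : List (X × Bool)) (q r : Ω) :
        r ≤ wordAct (fun a => act (letterVal v a)) w q →
          wordAct (fun a => act (letterVal v a)) (LTerm.invWord w) r ≤ q := fun H => by
      simpa only [h.wordAct_invWord] using h.wordAct_mono v (LTerm.invWord w) H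
    constructor
    · intro D hD
      obtain ⟨f, hf, rfl⟩ := List.mem_map.1 hD
      obtain ⟨w, hw, hwC⟩ : ∃ w ∈ f, w ∈ C₀ := by
        exact List.exists_mem_of_mem_sections hf hC₀
      exact ⟨_, List.mem_map_of_mem hw, hinv w _ _ (h2 w hwC)⟩
    · obtain ⟨f, hf, hf'⟩ : ∃ f ∈ s.cnf.sections, ∀ w ∈ f,
          p ≤ wordAct (fun a => act (letterVal v a)) w (act (s.eval v)⁻¹ p) := by
        exact List.exists_mem_sections h1
      refine ⟨_, List.mem_map_of_mem hf, fun w hw => ?_⟩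
      obtain ⟨z, hz, rfl⟩ := List.mem_map.1 hw
      exact hinv' z _ _ (hf' z hz)
  | mul s t ihs iht =>
    obtain ⟨ht, D, hD, hD'⟩ := iht p
    obtain ⟨hs, C, hC, hC'⟩ := ihs (act (t.eval v) p)
    simp only [LTerm.cnf, LTerm.eval, h.mul_act]
    constructor
    · intro E hE
      obtain ⟨C, hC, hE⟩ := List.mem_flatMap.1 hE
      obtain ⟨D, hD, rfl⟩ := List.mem_map.1 hE
      obtain ⟨w, hw, hw'⟩ := hs C hC
      obtain ⟨z, hz, hz'⟩ := ht D hD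
      refine ⟨w ++ z, List.mem_flatMap.2 ⟨w, hw, List.mem_map_of_mem hz⟩, ?_⟩
      rw [wordAct_append]
      exact hw'.trans (h.wordAct_mono v w hz')
    · refine ⟨LTerm.mulClause C D, List.mem_flatMap.2 ⟨C, hC, List.mem_map_of_mem hD⟩,
        fun x hx => ?_⟩
      obtain ⟨w, hw, hx⟩ := List.mem_flatMap.1 hx
      obtain ⟨z, hz, rfl⟩ := List.mem_map.1 hx
      rw [wordAct_append]
      exact (h.wordAct_mono v w (hD' z hz)).trans (hC' w hw)
  | inf s t ihs iht =>
    obtain ⟨ht, D, hD, hD'⟩ := iht p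
    obtain ⟨hs, C, hC, hC'⟩ := ihs p
    simp only [LTerm.cnf, LTerm.eval, h.inf_act]
    constructor
    · intro E hE
      rcases List.mem_append.1 hE with hE | hE
      · obtain ⟨w, hw, hw'⟩ := hs E hE
        exact ⟨w, hw, inf_le_left.trans hw'⟩
      · obtain ⟨w, hw, hw'⟩ := ht E hE
        exact ⟨w, hw, inf_le_right.trans hw'⟩
    · rcases le_total (act (s.eval v) p) (act (t.eval v) p) with H | H
      · rw [inf_eq_left.2 H]
        exact ⟨C, List.mem_append_left _ hC, hC'⟩
      · rw [inf_eq_right.2 H]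
        exact ⟨D, List.mem_append_right _ hD, hD'⟩
  | sup s t ihs iht =>
    obtain ⟨ht, D, hD, hD'⟩ := iht p
    obtain ⟨hs, C, hC, hC'⟩ := ihs p
    simp only [LTerm.cnf, LTerm.eval, h.sup_act]
    constructor
    · intro E hE
      obtain ⟨C, hC, hE⟩ := List.mem_flatMap.1 hE
      obtain ⟨D, hD, rfl⟩ := List.mem_map.1 hE
      rcases le_total (act (s.eval v) p) (act (t.eval v) p) with H | H
      · rw [sup_eq_right.2 H]
        obtain ⟨w, hw, hw'⟩ := ht D hD
        exact ⟨w, List.mem_append_right _ hw, hw'⟩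
      · rw [sup_eq_left.2 H]
        obtain ⟨w, hw, hw'⟩ := hs C hC
        exact ⟨w, List.mem_append_left _ hw, hw'⟩
    · refine ⟨C ++ D, List.mem_flatMap.2 ⟨C, hC, List.mem_map_of_mem hD⟩, fun w hw => ?_⟩
      rcases List.mem_append.1 hw with hw | hw
      · exact (hC' w hw).trans le_sup_left
      · exact (hD' w hw).trans le_sup_right

end Group

/-! ### Meets and joins of inverse-free words on a chain. -/

section Monoid

variable [Monoid M] [Lattice M] {act : M → Ω → Ω}

open LEquation

theorem act_wordTerm (h : IsLatticeAction act) (v : X → M) (w : List X)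
    (hw : (wordTerm w).InverseFree) (p : Ω) :
    act ((wordTerm w).evalFree v hw) p = wordAct (fun x => act (v x)) w p := by
  induction w with
  | nil => exact h.one_act p
  | cons x w ih => exact (h.mul_act _ _ _).trans (congrArg _ (ih hw.2))

theorem le_act_infTerm (h : IsLatticeAction act) (v : X → M) (w : List X) (l : List (List X))
    (hl : (infTerm w l).InverseFree) (p q : Ω) :
    q ≤ act ((infTerm w l).evalFree v hl) p ↔
      ∀ a ∈ w :: l, q ≤ wordAct (fun x => act (v x)) a p := by
  induction l with
  | nil =>
    rw [List.forall_mem_singleton, ← h.act_wordTerm v w (inverseFree_wordTerm w)]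
    rfl
  | cons a l ih =>
    have e : act ((infTerm w (a :: l)).evalFree v hl) p =
        act ((wordTerm a).evalFree v hl.1) p ⊓ act ((infTerm w l).evalFree v hl.2) p :=
      h.inf_act _ _ _
    rw [e, le_inf_iff, ih hl.2, h.act_wordTerm]
    simp only [List.forall_mem_cons]
    tauto

theorem act_supTerm_le (h : IsLatticeAction act) (v : X → M) (w : List X) (l : List (List X))
    (hl : (supTerm w l).InverseFree) (p q : Ω) :
    act ((supTerm w l).evalFree v hl) p ≤ q ↔
      ∀ a ∈ w :: l, wordAct (fun x => act (v x)) a p ≤ q := by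
  induction l with
  | nil =>
    rw [List.forall_mem_singleton, ← h.act_wordTerm v w (inverseFree_wordTerm w)]
    rfl
  | cons a l ih =>
    have e : act ((supTerm w (a :: l)).evalFree v hl) p =
        act ((wordTerm a).evalFree v hl.1) p ⊔ act ((supTerm w l).evalFree v hl.2) p :=
      h.sup_act _ _ _
    rw [e, sup_le_iff, ih hl.2, h.act_wordTerm]
    simp only [List.forall_mem_cons]
    tauto

end Monoid

end IsLatticeAction

end Word

/-! ### Extending finite partial automorphisms of the rationals -/

namespace Order

/-- Cantor's back-and-forth argument, with the generic ideal of partial isomorphisms started at `f`.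
-/
theorem PartialIso.exists_orderIso {α : Type*} [LinearOrder α] [Countable α] [DenselyOrdered α]
    [NoMinOrder α] [NoMaxOrder α] [Nonempty α] (f : PartialIso α α) :
    ∃ e : α ≃o α, ∀ q ∈ f.val, e q.1 = q.2 := by
  cases nonempty_encodable α
  let to_cofinal : α ⊕ α → Cofinal (PartialIso α α) := fun p ↦
    Sum.recOn p (definedAtLeft α) (definedAtRight α)
  let I : Ideal (PartialIso α α) := idealOfCofinals f to_cofinal
  let F a := funOfIdeal a I (cofinal_meets_idealOfCofinals _ to_cofinal (Sum.inl a))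
  let G b := invOfIdeal b I (cofinal_meets_idealOfCofinals _ to_cofinal (Sum.inr b))
  refine ⟨OrderIso.ofCmpEqCmp (fun a ↦ (F a).val) (fun b ↦ (G b).val) fun a b ↦ ?_, fun q hq => ?_⟩
  · rcases (F a).prop with ⟨f', hf, ha⟩
    rcases (G b).prop with ⟨g, hg, hb⟩
    rcases I.directed _ hf _ hg with ⟨m, _, fm, gm⟩
    exact m.prop (a, _) (fm ha) (_, b) (gm hb)
  -- A common extension contains both `q` and the pair given by `F` at `q.1`; equal first
  -- coordinates force equal second ones.
  · rcases (F q.1).prop with ⟨g, hg, ha⟩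
    rcases I.directed _ (mem_idealOfCofinals f to_cofinal) _ hg with ⟨m, _, fm, gm⟩
    have h := m.prop q (fm hq) (q.1, _) (gm ha)
    rw [cmp_self_eq_eq] at h
    exact (cmp_eq_eq_iff _ _ |>.1 h.symm).symm

end Order

theorem cmp_eq_cmp_of_lt_iff {α β : Type*} [LinearOrder α] [LinearOrder β] {a b : α} {c d : β}
    (h : a < b ↔ c < d) (h' : b < a ↔ d < c) : cmp a b = cmp c d := by
  simp [cmp, cmpUsing, h, h']

/-! ### A strict refinement of the preorder of words. -/

section Key

variable {Y Ω : Type*}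

/-- The sequence of the values of all suffixes of a word, together with their first letters. Ordered
lexicographically, these sequences refine the preorder of words by their values to an order that is
strictly preserved by adding a letter. -/
def wordKey (f : Y → Ω → Ω) (p : Ω) : List Y → List (Ω ×ₗ WithBot Y)
  | [] => [toLex (p, ⊥)]
  | y :: w => toLex (wordAct f (y :: w) p, (y : WithBot Y)) :: wordKey f p w

variable {f : Y → Ω → Ω} {p : Ω}

theorem exists_wordKey_eq (w : List Y) :
    ∃ b l, wordKey f p w = toLex (wordAct f w p, b) :: l := by
  cases w with
  | nil => exact ⟨_, _, rfl⟩
  | cons y w => exact ⟨_, _, rfl⟩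

variable [LinearOrder Y] [LinearOrder Ω]

theorem wordKey_lt_of_lt {w w' : List Y} (h : wordAct f w p < wordAct f w' p) :
    wordKey f p w < wordKey f p w' := by
  obtain ⟨b, l, e⟩ := exists_wordKey_eq (f := f) (p := p) w
  obtain ⟨b', l', e'⟩ := exists_wordKey_eq (f := f) (p := p) w'
  rw [e, e', List.cons_lt_cons_iff]
  exact Or.inl (Prod.Lex.toLex_lt_toLex.2 (Or.inl h))

theorem wordAct_le_of_wordKey_le {w w' : List Y} (h : wordKey f p w ≤ wordKey f p w') :
    wordAct f w p ≤ wordAct f w' p :=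
  le_of_not_gt fun H => (wordKey_lt_of_lt H).not_ge h

/-- A monotone `f y` may identify two values, but then the tie is broken by the tails, which are the
old keys. -/
theorem wordKey_cons_lt (hf : ∀ y, Monotone (f y)) (y : Y) {w w' : List Y}
    (h : wordKey f p w < wordKey f p w') : wordKey f p (y :: w) < wordKey f p (y :: w') := by
  have h1 : wordAct f (y :: w) p ≤ wordAct f (y :: w') p := hf y (wordAct_le_of_wordKey_le h.le)
  rw [wordKey, wordKey, List.cons_lt_cons_iff]
  rcases h1.lt_or_eq with h1 | h1
  · exact Or.inl (Prod.Lex.toLex_lt_toLex.2 (Or.inl h1))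
  · exact Or.inr ⟨by rw [h1], h⟩

theorem wordKey_cons_eq (y : Y) {w w' : List Y} (h : wordKey f p w = wordKey f p w') :
    wordKey f p (y :: w) = wordKey f p (y :: w') := by
  have h1 : wordAct f w p = wordAct f w' p :=
    le_antisymm (wordAct_le_of_wordKey_le h.le) (wordAct_le_of_wordKey_le h.ge)
  have h2 : wordAct f (y :: w) p = wordAct f (y :: w') p := congrArg (f y) h1
  rw [wordKey, wordKey, h, h2]

theorem wordKey_cons_lt_iff (hf : ∀ y, Monotone (f y)) (y : Y) (w w' : List Y) :
    wordKey f p (y :: w) < wordKey f p (y :: w') ↔ wordKey f p w < wordKey f p w' := by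
  refine ⟨fun h => ?_, wordKey_cons_lt hf y⟩
  rcases lt_trichotomy (wordKey f p w) (wordKey f p w') with h' | h' | h'
  · exact h'
  · exact absurd (wordKey_cons_eq y h') h.ne
  · exact absurd (wordKey_cons_lt hf y h') h.asymm

end Key

/-- Strict inequalities between the values of finitely many words that act by order-preserving maps
on a chain can be realized by automorphisms of a countable dense chain. -/
theorem exists_orderIso_wordAct_lt {Y Ω α : Type*} [LinearOrder Ω] [LinearOrder α] [Countable α]
    [DenselyOrdered α] [NoMinOrder α] [NoMaxOrder α] [Nonempty α] {f : Y → Ω → Ω}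
    (hf : ∀ y, Monotone (f y)) (p : Ω) (S : Finset (List Y)) :
    ∃ (g : Y → α ≃o α) (o : α), ∀ a ∈ S, ∀ b ∈ S, wordAct f a p < wordAct f b p →
      wordAct (fun y => g y) a o < wordAct (fun y => g y) b o := by
  classical
  let : LinearOrder Y := linearOrderOfSTO WellOrderingRel
  -- Closure under suffixes keeps the evaluation of a word, letter by letter, inside the finite set.
  let S' : Finset (List Y) := insert [] (S.biUnion fun w => w.tails.toFinset)
  have hS' {w : List Y} {y : Y} (h : y :: w ∈ S') : w ∈ S' := by
    simp only [S', Finset.mem_insert, Finset.mem_biUnion, List.mem_toFinset, List.mem_tails,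
      reduceCtorEq, false_or] at h ⊢
    obtain ⟨a, ha, h⟩ := h
    exact Or.inr ⟨a, ha, (List.suffix_cons y w).trans h⟩
  have hS {w : List Y} (h : w ∈ S) : w ∈ S' := by
    simp only [S', Finset.mem_insert, Finset.mem_biUnion, List.mem_toFinset, List.mem_tails]
    exact Or.inr ⟨w, h, List.suffix_rfl⟩
  let K : Finset (List (Ω ×ₗ WithBot Y)) := S'.image (wordKey f p)
  obtain ⟨j₀⟩ := Order.embedding_from_countable_to_dense K α
  -- Only words in `S'` are ever compared, so the arbitrary value plays no role.
  let j (w : List Y) : α := if h : wordKey f p w ∈ K then j₀ ⟨_, h⟩ else Classical.arbitrary α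
  have hj {a b : List Y} (ha : a ∈ S') (hb : b ∈ S') :
      j a < j b ↔ wordKey f p a < wordKey f p b := by
    have ha' : wordKey f p a ∈ K := Finset.mem_image_of_mem _ ha
    have hb' : wordKey f p b ∈ K := Finset.mem_image_of_mem _ hb
    simp only [j, ha', hb', dif_pos]
    exact j₀.lt_iff_lt
  have hg (y : Y) : ∃ e : α ≃o α, ∀ w ∈ S', y :: w ∈ S' → e (j w) = j (y :: w) := by
    -- Prefixing `y` preserves and reflects the order of keys, so these pairs form a partial
    -- isomorphism.
    let P : Order.PartialIso α α :=
      ⟨(S'.filter fun w => y :: w ∈ S').image fun w => (j w, j (y :: w)), by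
        intro q hq r hr
        obtain ⟨a, ha, rfl⟩ := Finset.mem_image.1 hq
        obtain ⟨b, hb, rfl⟩ := Finset.mem_image.1 hr
        rw [Finset.mem_filter] at ha hb
        refine cmp_eq_cmp_of_lt_iff ?_ ?_
        · rw [hj ha.1 hb.1, hj ha.2 hb.2, wordKey_cons_lt_iff hf]
        · rw [hj hb.1 ha.1, hj hb.2 ha.2, wordKey_cons_lt_iff hf]⟩
    obtain ⟨e, he⟩ := P.exists_orderIso
    exact ⟨e, fun w hw hyw => he (j w, j (y :: w))
      (Finset.mem_image.2 ⟨w, Finset.mem_filter.2 ⟨hw, hyw⟩, rfl⟩)⟩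
  choose g hg using hg
  have hact (w : List Y) (hw : w ∈ S') : wordAct (fun y => g y) w (j []) = j w := by
    induction w with
    | nil => rfl
    | cons y w ih =>
      have h1 : wordAct (fun y => g y) (y :: w) (j []) = g y (wordAct (fun y => g y) w (j [])) := rfl
      rw [h1, ih (hS' hw), hg y w (hS' hw) hw]
  refine ⟨g, j [], fun a ha b hb h => ?_⟩
  rw [hact a (hS ha), hact b (hS hb), hj (hS ha) (hS hb)]
  exact wordKey_lt_of_lt h

/-! ### Validity of the equation of a clause -/

namespace LEquation

open LTerm

/-! ### Failure of an inequality at one point of a chain. -/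

section Inequality

variable {X : Type u} {a b : List X} {A B : List (List X)}

theorem evalFree_wordInequality_ne {M Ω : Type*} [Monoid M] [Lattice M] [LinearOrder Ω]
    {act : M → Ω → Ω} (h : IsLatticeAction act) (v : X → M) {p q r : Ω} (hrq : r < q)
    (hA : ∀ c ∈ a :: A, q ≤ wordAct (fun x => act (v x)) c p)
    (hB : ∀ c ∈ b :: B, wordAct (fun x => act (v x)) c p ≤ r)
    (hfree : (wordInequality a A b B).InverseFree) :
    (wordInequality a A b B).1.evalFree v hfree.1 ≠ (wordInequality a A b B).2.evalFree v hfree.2 := by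
  intro H
  have h1 := (h.le_act_infTerm v a A hfree.2 p q).2 hA
  have h2 := (h.act_supTerm_le v b B hfree.1.2 p r).2 hB
  have h3 : act ((infTerm a A).evalFree v hfree.2) p ≤
      act ((supTerm b B).evalFree v hfree.1.2) p := by
    have h4 := congrArg (fun m => act m p) H
    have h5 : act ((infTerm a A).evalFree v hfree.1.1 ⊓ (supTerm b B).evalFree v hfree.1.2) p =
      act ((infTerm a A).evalFree v hfree.2) p := h4
    rw [h.inf_act] at h5
    exact inf_eq_left.1 h5
  exact (h1.trans (h3.trans h2)).not_gt hrq

theorem exists_wordAct_lt {M : Type w} [DistribLMonoid M] (v : X → M)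
    (hfree : (wordInequality a A b B).InverseFree)
    (hne : (wordInequality a A b B).1.evalFree v hfree.1 ≠
      (wordInequality a A b B).2.evalFree v hfree.2) :
    ∃ (Ω : Type w) (_ : LinearOrder Ω) (f : X → Ω → Ω) (p : Ω), (∀ x, Monotone (f x)) ∧
      ∀ c ∈ a :: A, ∀ d ∈ b :: B, wordAct f d p < wordAct f c p := by
  have hle : ¬ (infTerm a A).evalFree v hfree.2 ≤ (supTerm b B).evalFree v hfree.1.2 := fun h =>
    hne (inf_eq_left.2 h)
  obtain ⟨Ω, _, act, h, p, hp⟩ := DistribLMonoid.exists_isLatticeAction hle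
  exact ⟨Ω, _, fun x => act (v x), p, fun x => h.mono _, fun c hc d hd =>
    ((h.act_supTerm_le v b B hfree.1.2 p _).1 le_rfl d hd).trans_lt
      (hp.trans_le ((h.le_act_infTerm v a A hfree.2 p _).1 le_rfl c hc))⟩

end Inequality

/-! ### From a failing clause to order-preserving maps. -/

section ToMonoid

variable {X : Type u} {Ω : Type w}

/-- The word that consists of the letters before the first separator. -/
def headWord {α : Type*} : List (Option α) → List α
  | some a :: T => a :: headWord T
  | _ => []

theorem headWord_tokens_cons (w : List (X × Bool)) (C : List (List (X × Bool))) :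
    headWord (tokens (w :: C)) = w := by
  induction w with
  | nil => rfl
  | cons a w ih => exact congrArg (a :: ·) ih

/-- Apart from the leading one, separators stand only at ends of words, so a new word or the end of
the clause follows each of them. -/
theorem eq_tokens_of_suffix {C : List (List (X × Bool))} {T : List (Option (X × Bool))}
    (h : none :: T <:+ none :: tokens C) : ∃ D, D <:+ C ∧ T = tokens D := by
  induction C with
  | nil =>
    have := h.length_le
    simp [tokens] at this
    exact ⟨[], List.suffix_rfl, this⟩
  | cons w C ih =>
    rcases List.suffix_cons_iff.1 h with h' | h'
    · exact ⟨_, List.suffix_rfl, by simpa using h'⟩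
    · have h1 : none :: T <:+ none :: tokens C := by
        have e : tokens (w :: C) = w.map some ++ none :: tokens C := by simp [tokens]
        rw [e] at h'
        clear ih e h
        induction w with
        | nil => exact h'
        | cons a w ih =>
          rcases List.suffix_cons_iff.1 h' with h | h
          · simp at h
          · exact ih h
      obtain ⟨D, hD, rfl⟩ := ih h1
      exact ⟨D, hD.trans (List.suffix_cons _ _), rfl⟩

/-- The map of a chain that is constant above and below a threshold `c`. -/
def threshold {Λ : Type*} [LinearOrder Λ] {r q : Λ} (h : r ≤ q) (c : Λ) : Λ →o Λ where
  toFun x := if c ≤ x then q else r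
  monotone' x y hxy := by
    dsimp only
    split_ifs with h1 h2
    · exact le_rfl
    · exact absurd (h1.trans hxy) h2
    · exact h
    · exact le_rfl

/-- The lifting of an order-preserving map of a chain that is strict to a lexicographic product. -/
def lexLift [LinearOrder Ω] {f : Ω → Ω} (h : StrictMono f) : (Ω ×ₗ ℤ) →o (Ω ×ₗ ℤ) where
  toFun x := toLex (f (ofLex x).1, (ofLex x).2)
  monotone' x y hxy := by
    rcases Prod.Lex.le_iff.1 hxy with h1 | ⟨h1, h2⟩
    · exact Prod.Lex.toLex_le_toLex.2 (Or.inl (h h1))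
    · exact Prod.Lex.toLex_le_toLex.2 (Or.inr ⟨congrArg f h1, h2⟩)

/-- The point of a list of tokens: the value of its head word, with a second coordinate that
decreases in the course of reading. -/
def tokenPoint (f : X × Bool → Ω → Ω) (p : Ω) : List (Option (X × Bool)) → Ω ×ₗ ℤ
  | [] => toLex (p, -1)
  | a :: T => toLex (wordAct f (headWord (a :: T)) p, ((headWord (a :: T)).length : ℤ) + 1)

theorem exists_tokenPoint_eq (f : X × Bool → Ω → Ω) (p : Ω) (T : List (Option (X × Bool))) :
    ∃ n : ℤ, n ≤ (headWord T).length + 1 ∧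
      tokenPoint f p T = toLex (wordAct f (headWord T) p, n) := by
  cases T with
  | nil => exact ⟨-1, by simp [headWord], rfl⟩
  | cons a T => exact ⟨_, le_rfl, rfl⟩

/-- If all words of a clause move a point down, then the inverse-free equation of the clause fails
in the distributive lattice-ordered monoid of order-preserving maps of some chain. -/
theorem not_validDLM_clauseEquation [LinearOrder Ω] {G : Type*} [Group G] [Lattice G] {act : G → Ω → Ω}
    (h : IsLatticeAction act) (v : X → G) {p : Ω} {C : List (List (X × Bool))}
    (hC : ∀ w ∈ C, wordAct (fun a => act (letterVal v a)) w p < p)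
    (hfree : (clauseEquation C).InverseFree) : ¬ ValidDLM.{u, w} (clauseEquation C) hfree := by
  intro hvalid
  set f : X × Bool → Ω → Ω := fun a => act (letterVal v a)
  let lift (g : G) : (Ω ×ₗ ℤ) →o (Ω ×ₗ ℤ) := lexLift (h.strictMono g)
  have lift_lift (x : X) (c : Ω ×ₗ ℤ) : lift (v x) (lift (v x)⁻¹ c) = c := by
    apply ofLex.injective
    exact Prod.ext (h.act_inv_act _ _) rfl
  -- The coordinate 0 lies strictly between -1, used for the empty token list, and the positive
  -- values used for all other lists.
  let base : Ω ×ₗ ℤ := toLex (p, 0)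
  let below : Ω ×ₗ ℤ := toLex (p, -1)
  have hlt : below < base := Prod.Lex.toLex_lt_toLex.2 (Or.inr ⟨rfl, by norm_num⟩)
  let T := none :: tokens C
  -- A suffix of `T` is determined by its length, which is what the index of a variable records.
  let suffix (n : ℕ) := T.drop (T.length - n)
  have suffix_length {S : List (Option (X × Bool))} (hS : S <:+ T) : suffix S.length = S :=
    (List.suffix_iff_eq_drop.1 hS).symm
  let point := tokenPoint f p
  -- The constant value of `z_S`: for an inverse letter, `x` must carry it to the point of the tail.
  -- The value at `[]` belongs to variable 3, which occurs in no pair.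
  let source : List (Option (X × Bool)) → Ω ×ₗ ℤ
    | some (x, false) :: S => lift (v x)⁻¹ (point S)
    | _ :: S => point S
    | [] => base
  let thr : ℕ → Ω ×ₗ ℤ
    | 0 => base
    | n + 1 => point (suffix n)
  let src : ℕ → Ω ×ₗ ℤ
    | 0 => base
    | n + 1 => source (suffix n)
  let val : X ⊕ ℕ → ((Ω ×ₗ ℤ) →o (Ω ×ₗ ℤ)) := Sum.elim (fun x => lift (v x)) fun i =>
    if i % 2 = 0 then threshold hlt.le (thr (i / 2)) else OrderHom.const _ (src (i / 2))
  have val_even (n : ℕ) (c : Ω ×ₗ ℤ) :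
      val (Sum.inr (2 * n)) c = if thr n ≤ c then base else below := by
    have h1 : (2 * n) % 2 = 0 := by omega
    have h2 : (2 * n) / 2 = n := by omega
    simp only [val, Sum.elim_inr, h1, h2, if_true]
    rfl
  have val_odd (n : ℕ) (c : Ω ×ₗ ℤ) : val (Sum.inr (2 * n + 1)) c = src n := by
    have h1 : (2 * n + 1) % 2 = 1 := by omega
    have h2 : (2 * n + 1) / 2 = n := by omega
    simp only [val, Sum.elim_inr, h1, h2]
    rfl
  -- The first coordinates agree; the strict inequality comes from the length in the second.
  have lift_lt (a : X × Bool) (S : List (Option (X × Bool))) :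
      lift (letterVal v a) (point S) < point (some a :: S) := by
    obtain ⟨n, hn, e⟩ := exists_tokenPoint_eq f p S
    have e' : point S = _ := e
    rw [e']
    refine Prod.Lex.toLex_lt_toLex.2 (Or.inr ⟨rfl, ?_⟩)
    simp only [headWord, List.length_cons, ofLex_toLex]
    push_cast
    omega
  -- Only here is it used that the words of the clause move `p` down.
  have point_lt (S : List (Option (X × Bool))) (hS : none :: S <:+ T) : point S < base := by
    obtain ⟨D, hD, rfl⟩ := eq_tokens_of_suffix hS
    rcases D with _ | ⟨w, D⟩
    · exact hlt
    · obtain ⟨n, hn, e⟩ := exists_tokenPoint_eq f p (tokens (w :: D))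
      have e' : point (tokens (w :: D)) = _ := e
      rw [e', headWord_tokens_cons]
      exact Prod.Lex.toLex_lt_toLex.2 (Or.inl (hC w (hD.subset List.mem_cons_self)))
  have hy {S : List (Option (X × Bool))} (hS : S <:+ T) (c : Ω ×ₗ ℤ) :
      val (Sum.inr (2 * S.length + 2)) c = if point S ≤ c then base else below := by
    have := val_even (S.length + 1) c
    simp only [thr, suffix_length hS] at this
    exact this
  have hy' {a : Option (X × Bool)} {S : List (Option (X × Bool))} (hS : a :: S <:+ T)
      (c : Ω ×ₗ ℤ) : val (Sum.inr (2 * S.length + 4)) c =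
        if point (a :: S) ≤ c then base else below := hy hS c
  have hz {a : Option (X × Bool)} {S : List (Option (X × Bool))} (hS : a :: S <:+ T)
      (c : Ω ×ₗ ℤ) : val (Sum.inr (2 * S.length + 5)) c = source (a :: S) := by
    have := val_odd ((a :: S).length + 1) c
    simp only [src, suffix_length hS] at this
    exact this
  have hy0 (c : Ω ×ₗ ℤ) : val (Sum.inr 0) c = if base ≤ c then base else below := val_even 0 c
  have hz0 (c : Ω ×ₗ ℤ) : val (Sum.inr 1) c = base := val_odd 0 c
  have base_lt (S : List (Option (X × Bool))) : base < point (none :: S) :=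
    Prod.Lex.toLex_lt_toLex.2 (Or.inr ⟨rfl, by simp [headWord]⟩)
  have pairs (S : List (Option (X × Bool))) (hS : S <:+ T) : ∀ c ∈ tokenPairs S,
      wordAct (fun x => val x) c.1 base = base ∧ wordAct (fun x => val x) c.2 base = below := by
    induction S with
    | nil => simp [tokenPairs]
    | cons a S ih =>
      have hS' := (List.suffix_cons a S).trans hS
      rw [tokenPairs, List.forall_mem_append]
      refine ⟨?_, ih hS'⟩
      rcases a with _ | ⟨x, _ | _⟩
      · have h1 := (base_lt S).not_ge
        have h2 := (point_lt S hS).not_ge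
        simp [tokenStep, wordAct, hy0, hz0, hy hS', hy' hS, hz hS, source, h1, h2]
      · have h1 : ¬ point (some (x, false) :: S) ≤ lift (v x)⁻¹ (point S) :=
          (lift_lt (x, false) S).not_ge
        have h2 (c : Ω ×ₗ ℤ) : val (Sum.inl x) c = lift (v x) c := rfl
        simp [tokenStep, wordAct, hy hS', hy' hS, hz hS, source, h1, h2, lift_lift]
      · have h1 : ¬ point (some (x, true) :: S) ≤ lift (v x) (point S) :=
          (lift_lt (x, true) S).not_ge
        have h2 (c : Ω ×ₗ ℤ) : val (Sum.inl x) c = lift (v x) c := rfl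
        simp [tokenStep, wordAct, hy hS', hy' hS, hz hS, source, h1, h2]
  refine evalFree_wordInequality_ne (DistribLMonoid.isLatticeAction_orderHom (Ω ×ₗ ℤ)) val hlt
    (p := base) ?_ ?_ hfree (hvalid _ val)
  · rw [List.forall_mem_cons]
    refine ⟨?_, fun c hc => ?_⟩
    · simp [wordAct, hy0, hz0]
    · obtain ⟨d, hd, rfl⟩ := List.mem_map.1 hc
      exact (pairs T List.suffix_rfl d hd).1.ge
  · rw [List.forall_mem_cons]
    refine ⟨?_, fun c hc => ?_⟩
    -- The extra words that keep the meet and the join nonempty are the first pair of the leading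
    -- separator.
    · exact (pairs T List.suffix_rfl ([Sum.inr 0, Sum.inr 1], _)
        (List.mem_append_left _ List.mem_cons_self)).2.le
    · obtain ⟨d, hd, rfl⟩ := List.mem_map.1 hc
      exact (pairs T List.suffix_rfl d hd).2.le

end ToMonoid

/-! ### From a failing inverse-free equation to automorphisms. -/

section ToGroup

variable {X : Type u} {α : Type*} [LinearOrder α] {g : X ⊕ ℕ → α ≃o α} {o m : α}

/-- The condition that the first words of the pairs of a list of tokens move a point `o` above `m`
and the second words move it strictly below `m`. -/
def Separates (g : X ⊕ ℕ → α ≃o α) (o m : α) (T : List (Option (X × Bool))) : Prop :=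
  ∀ c ∈ tokenPairs T, m ≤ wordAct (fun x => g x) c.1 o ∧ wordAct (fun x => g x) c.2 o < m

/-- The separator after `w` starts the chain of estimates with `q < q_{none T}`, and each letter,
from right to left, prolongs it by `a q_S < q_{aS}`. -/
theorem Separates.wordAct_lt {w : List (X × Bool)} {T : List (Option (X × Bool))}
    (h : Separates g o m (w.map some ++ none :: T)) :
    Separates g o m (none :: T) ∧
      wordAct (fun a => ⇑(letterVal (fun x => g (Sum.inl x)) a)) w ((g (Sum.inr 0)).symm m) <
        (g (Sum.inr (2 * (w.map some ++ none :: T).length + 2))).symm m := by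
  induction w with
  | nil =>
    refine ⟨h, ?_⟩
    have h1 := h _ (List.mem_append_left _ List.mem_cons_self)
    simp only [wordAct, List.foldr_cons, List.foldr_nil] at h1
    exact ((g _).symm_apply_le.2 h1.1).trans_lt ((g _).lt_symm_apply.2 h1.2)
  | cons a w ih =>
    obtain ⟨h1, h2⟩ := ih fun c hc => h c (List.mem_append_right _ hc)
    refine ⟨h1, ?_⟩
    set n := (w.map some ++ none :: T).length
    rcases a with ⟨x, _ | _⟩
    · have h3 := h _ (List.mem_append_left _ List.mem_cons_self)
      simp only [wordAct, List.foldr_cons, List.foldr_nil] at h3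
      have h4 := h2.trans_le ((g _).symm_apply_le.2 h3.1)
      exact ((g (Sum.inl x)).symm_apply_lt.2 h4).trans ((g _).lt_symm_apply.2 h3.2)
    · have h3 := h _ (List.mem_append_left _ List.mem_cons_self)
      simp only [wordAct, List.foldr_cons, List.foldr_nil] at h3
      have h4 := h2.trans_le ((g _).symm_apply_le.2 h3.1)
      exact ((g (Sum.inl x)).strictMono h4).trans ((g _).lt_symm_apply.2 h3.2)

/-- The separator before a word closes the chain: its second pair puts `q_S` below `q`. -/
theorem Separates.forall_wordAct_lt {C : List (List (X × Bool))}
    (h : Separates g o m (none :: tokens C)) : ∀ w ∈ C,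
      wordAct (fun a => ⇑(letterVal (fun x => g (Sum.inl x)) a)) w ((g (Sum.inr 0)).symm m) <
        (g (Sum.inr 0)).symm m := by
  induction C with
  | nil => simp
  | cons w C ih =>
    have e : tokens (w :: C) = w.map some ++ none :: tokens C := by simp [tokens]
    rw [e] at h
    have h1 := h _ (List.mem_append_left _ (List.mem_cons_of_mem _ List.mem_cons_self))
    simp only [wordAct, List.foldr_cons, List.foldr_nil] at h1
    obtain ⟨h2, h3⟩ := Separates.wordAct_lt (g := g) (o := o) (m := m) (w := w) (T := tokens C)
      fun c hc => h c (List.mem_append_right _ hc)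
    rw [List.forall_mem_cons]
    exact ⟨h3.trans (((g _).symm_apply_le.2 h1.1).trans_lt ((g _).lt_symm_apply.2 h1.2)), ih h2⟩

/-- If the inverse-free equation of a clause fails in some distributive lattice-ordered monoid, then
all words of the clause move some point of a countable dense chain down, for some assignment of
automorphisms to the variables. -/
theorem exists_forall_wordAct_lt [Countable α] [DenselyOrdered α] [NoMinOrder α] [NoMaxOrder α]
    [Nonempty α] {C : List (List (X × Bool))} {hfree : (clauseEquation C).InverseFree}
    (h : ¬ ValidDLM.{u, w} (clauseEquation C) hfree) :
    ∃ (v : X → α ≃o α) (q : α), ∀ w ∈ C, wordAct (fun a => ⇑(letterVal v a)) w q < q := by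
  classical
  simp only [ValidDLM, not_forall] at h
  obtain ⟨M, _, v, hne⟩ := h
  obtain ⟨Ω, _, f, p, hf, hlt⟩ := exists_wordAct_lt v hfree hne
  set A := [Sum.inr 0, Sum.inr 1] :: (tokenPairs (none :: tokens C)).map Prod.fst
  set B := [Sum.inr (2 * (tokens C).length + 4), Sum.inr 1] ::
    (tokenPairs (none :: tokens C)).map Prod.snd
  obtain ⟨g, o, hg⟩ := exists_orderIso_wordAct_lt (α := α) hf p (A.toFinset ∪ B.toFinset)
  -- The level `m` is the least value of a word of the meet; all words of the join stay strictly
  -- below it.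
  obtain ⟨a, ha, hmin⟩ := Finset.exists_min_image A.toFinset (fun c => wordAct (fun x => g x) c o)
    ⟨[Sum.inr 0, Sum.inr 1], by simp [A]⟩
  refine ⟨fun x => g (Sum.inl x), _, Separates.forall_wordAct_lt (g := g) (o := o)
    (m := wordAct (fun x => g x) a o) fun c hc => ⟨?_, ?_⟩⟩
  · exact hmin _ (List.mem_toFinset.2 (List.mem_cons_of_mem _ (List.mem_map_of_mem hc)))
  · have hcB : c.2 ∈ B := List.mem_cons_of_mem _ (List.mem_map_of_mem hc)
    exact hg _ (Finset.mem_union_right _ (List.mem_toFinset.2 hcB)) _ (Finset.mem_union_left _ ha)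
      (hlt a (List.mem_toFinset.1 ha) _ hcB)

end ToGroup

/-! ### The elimination of inverses -/

variable {X : Type u}

theorem inverseFree_of_mem_eliminateInverses {ε : LEquation X} :
    ∀ σ ∈ (eliminateInverses X ε).2, σ.InverseFree := by
  intro σ hσ
  obtain ⟨C, _, rfl⟩ := List.mem_map.1 hσ
  exact inverseFree_wordInequality _ _ _ _

theorem validDLM_of_validLG {ε : LEquation X} (h : ValidLG.{u, w} ε) {σ : LEquation (X ⊕ ℕ)}
    (hσ : σ ∈ (eliminateInverses X ε).2) (hfree : σ.InverseFree) : ValidDLM.{u, w} σ hfree := by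
  obtain ⟨C, hC, rfl⟩ := List.mem_map.1 hσ
  by_contra hnot
  -- The rationals are lifted to the universe over which `ValidLG` quantifies.
  have : DenselyOrdered (ULift.{w} ℚ) := ⟨fun a b hab => by
    obtain ⟨c, h1, h2⟩ := exists_between (show a.down < b.down from hab)
    exact ⟨⟨c⟩, h1, h2⟩⟩
  have : NoMinOrder (ULift.{w} ℚ) := ⟨fun a => by
    obtain ⟨c, hc⟩ := exists_lt a.down
    exact ⟨⟨c⟩, hc⟩⟩
  have : NoMaxOrder (ULift.{w} ℚ) := ⟨fun a => by
    obtain ⟨c, hc⟩ := exists_gt a.down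
    exact ⟨⟨c⟩, hc⟩⟩
  obtain ⟨v, q, hq⟩ := exists_forall_wordAct_lt (α := ULift.{w} ℚ) hnot
  have hv := h (ULift.{w} ℚ ≃o ULift.{w} ℚ) v
  obtain ⟨w, hw, hle⟩ := (ChainAut.isLatticeAction.cnf_spec v
    (inf (mul (inv ε.1) ε.2) (mul (inv ε.2) ε.1)) q).1 C hC
  -- Validity makes the term equal to 1, so some word of `C` does not move `q` down.
  simp only [eval, hv, inv_mul_cancel, inf_idem] at hle
  exact (hq w hw).not_ge hle

theorem validLG_of_validDLM {ε : LEquation X}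
    (h : ∀ σ (hσ : σ ∈ (eliminateInverses X ε).2),
      ValidDLM.{u, w} σ (inverseFree_of_mem_eliminateInverses σ hσ)) : ValidLG.{u, w} ε := by
  intro G _ _ _ _ v
  by_contra hne
  set t := inf (mul (inv ε.1) ε.2) (mul (inv ε.2) ε.1)
  have hle : ¬ 1 ≤ t.eval v := by
    intro h1
    have h2 : 1 ≤ (ε.1.eval v)⁻¹ * ε.2.eval v ⊓ (ε.2.eval v)⁻¹ * ε.1.eval v := h1
    rw [le_inf_iff, le_inv_mul_iff_mul_le, le_inv_mul_iff_mul_le, mul_one, mul_one] at h2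
    exact hne (le_antisymm h2.1 h2.2)
  let := DistribLMonoid.ofGroup G
  obtain ⟨Ω, _, act, hact, p, hp⟩ := DistribLMonoid.exists_isLatticeAction hle
  -- The monoid structure of `ofGroup G` is by definition that of the group.
  have hact' : @IsLatticeAction G Ω (Group.toDivInvMonoid.toMonoid) _ _ act := hact
  obtain ⟨C, hC, hC'⟩ := (hact'.cnf_spec v t p).2
  have hp' : act (t.eval v) p < p := by
    have := hact'.one_act p
    exact hp.trans_eq this
  exact not_validDLM_clauseEquation hact' v (fun w hw => (hC' w hw).trans_lt hp')
    (inverseFree_wordInequality _ _ _ _) (h _ (List.mem_map_of_mem hC))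

end LEquation

theorem theoremt :
    ∃ F : (X : Type u) → LEquation X → ℕ × List (LEquation (X ⊕ ℕ)),
      (∀ (X : Type u) [Primcodable X], Computable (F X)) ∧
      (∀ (X Z : Type u) (e : X → Z), Function.Injective e → ∀ ε : LEquation X,
        F Z (ε.rename e) =
          ((F X ε).1, (F X ε).2.map (LEquation.rename (Sum.map e id)))) ∧
      ∀ (X : Type u) (ε : LEquation X),
        (∀ σ ∈ (F X ε).2, ∀ i : ℕ, Sum.inr i ∈ σ.vars → i < (F X ε).1) ∧
        ∃ hfree : ∀ σ ∈ (F X ε).2, σ.InverseFree,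
          (LEquation.ValidLG.{u, w} ε ↔
            ∀ (σ : LEquation (X ⊕ ℕ)) (hσ : σ ∈ (F X ε).2),
              LEquation.ValidDLM.{u, w} σ (hfree σ hσ)) :=
  ⟨LEquation.eliminateInverses, fun _ _ => LEquation.primrec_eliminateInverses.to_comp,
    fun _ _ e _ ε => LEquation.eliminateInverses_rename e ε, fun _ _ =>
    ⟨fun _ hσ _ hi => LEquation.lt_of_mem_vars_eliminateInverses hσ hi,
      LEquation.inverseFree_of_mem_eliminateInverses,
      fun h _ hσ => LEquation.validDLM_of_validLG h hσ _, LEquation.validLG_of_validDLM⟩⟩
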